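/- **Fermionic NLTS theorem.** *Setting.* A system of $N$ fermionic modes is the $2^N$-dimensional Fock space with Majorana operators $c_1,\dots,c_{2N}$: Hermitian, $c_k^2=\mathbb I$, $c_kc_l=-c_lc_k$ for $k\ne l$. For $K=\{k_1<\dots<k_r\}$ put $C_K=i^{r(r-1)/2}c_{k_1}\cdots c_{k_r}$. A *fermionic state* is a density matrix that is an even polynomial in the $c_k$. A *Gaussian circuit* is a finite product of unitaries $\exp(-\omega c_kc_l)$, $\omega\in\mathbb R$, $k\neq l$. A *pure Gaussian state* is $G\prod_{j=1}^N\frac12(\mathbb I+(-1)^{s_j}i\,c_{2j-1}c_{2j})\,G^\dagger$ with a Gaussian circuit $G$ and $s\in\{0,1\}^N$. A *layer* is a product $W=\prod_K\exp(i\omega_KC_K)$, $\omega_K\in\mathbb R$, over pairwise disjoint sets $K$ with $|K|\in\{2,4\}$. A *fermionic circuit of depth $T$* is $U=W_T\cdots W_1$ with layers $W_t$; a *depth-$T$ circuit with free access to Gaussian operations* is $U=G_TW_T\cdots G_1W_1$ with layers $W_t$ and arbitrary Gaussian circuits $G_t$. Such a circuit on $N+m$ modes *prepares* the $N$-mode state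 $\rho$ with $m$ ancillary modes if $\rho=\mathrm{Tr}_{\rm anc}(U\sigma U^\dagger)$ for some pure Gaussian state $\sigma$ of $N+m$ modes, where $\mathrm{Tr}_{\rm anc}$ traces out the last $m$ modes (the Majorana operators $c_k$ with $k>2N$). An $n$-qubit state $\rho$ is *$(\mu,L)$-spread* if there are a tensor product $R$ of single-qubit unitaries and sets $S_1,S_2\subset\{0,1\}^n$ such that $p(s)=\mathrm{Tr}\big(R^\dagger\prod_j\tfrac{1+(-1)^{s_j}Z_j}{2}R\,\rho\big)$ satisfies $\sum_{s\in S_1}p(s)\ge\mu$ and $\sum_{s\in S_2}p(s)\ge\mu$, and the minimal Hamming distance between an element of $S_1$ and an element of $S_2$ is $L$. For constants $\epsilon\in\mathbb R$ and $\mu,c>0$, an $n$-qubit Hamiltonian $H^{q}$ *has well-spread states below energy $\epsilon n$* (with constants $\mu,c$) if every $n$-qubit state $\rho$ with $\mathrm{Tr}(\rho H^{q})<\epsilon n$ is $(\mu,L)$-spread for some $L\ge cn$. For even $n$, label the Majorana operators of $3n/2$ modes, in any way, as $c_{x,j},c_{y,j},c_{z,j}$, $j=1,\dots,n$. For an $n$-qubit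 Hamiltonian $H^{q}$ let $H$ be the $3n/2$-mode fermionic Hamiltonian obtained by replacing, in the expansion of $H^q$ in products of Pauli operators, $$X_j\mapsto i\,c_{y,j}c_{z,j},\qquad Y_j\mapsto i\,c_{x,j}c_{z,j},\qquad Z_j\mapsto i\,c_{x,j}c_{y,j}.$$ *Theorem.* Let $\epsilon\in\mathbb R$, $\mu>0$, $c>0$. (0) If $H^{q}\ge 0$ is a sum of Hermitian terms of operator norm at most $1$, each acting on at most $k$ qubits, with each qubit acted on by at most $d$ terms, then $H\ge0$ is a sum of Hermitian terms of operator norm at most $1$, each an even polynomial in at most $3k$ Majorana operators, with each Majorana operator involved in at most $d$ terms. (1) There are $\delta>0$ and $n_0$, depending only on $\epsilon,\mu,c$, such that for all even $n\ge n_0$, every (Hermitian) $n$-qubit Hamiltonian $H^{q}$ with well-spread states below energy $\epsilon n$ (with constants $\mu,c$), and every $3n/2$-mode fermionic state $\rho$ with $\mathrm{Tr}(\rho H)<\epsilon n$: every fermionic circuit that prepares $\rho$ from any pure Gaussian state, with any number of ancillary modes, has depth $T\ge\delta\log n$. (2) For every $C$ there are $\delta>0$ and $n_0$, depending only on $\epsilon,\mu,c,C$,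 such that for all $n$, $H^{q}$, $\rho$ as in (1): every circuit with free access to Gaussian operations that prepares $\rho$ from any pure Gaussian state, with at most $Cn$ ancillary modes, has depth $T\ge\delta\log n$. -/

import Mathlib

open scoped ComplexOrder

noncomputable section

namespace FNLTS

/-! ### Operators on `n` two-level systems, Pauli operators -/

/-- Operators on the `2 ^ n`-dimensional space with orthonormal basis the bitstrings of length `n`.
It serves as the Hilbert space of `n` qubits and as the Fock space of `n` fermionic modes. -/
abbrev Op (n : ℕ) := Matrix (Fin n → Fin 2) (Fin n → Fin 2) ℂ

/-- The tensor product `A 0 ⊗ A 1 ⊗ ⋯ ⊗ A (n - 1)` of single-site operators. -/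
def tensorOp {n : ℕ} (A : Fin n → Matrix (Fin 2) (Fin 2) ℂ) : Op n :=
  Matrix.of fun s t => ∏ j, A j (s j) (t j)

def pauliX : Matrix (Fin 2) (Fin 2) ℂ := !![0, 1; 1, 0]

def pauliY : Matrix (Fin 2) (Fin 2) ℂ := !![0, -Complex.I; Complex.I, 0]

def pauliZ : Matrix (Fin 2) (Fin 2) ℂ := !![1, 0; 0, -1]

/-- The labels `0, 1, 2, 3` stand for the identity and the Pauli matrices `X, Y, Z`. -/
def pauli : Fin 4 → Matrix (Fin 2) (Fin 2) ℂ := ![1, pauliX, pauliY, pauliZ]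

/-- The Pauli string `⨂ j, pauli (P j)`. -/
def pauliString {n : ℕ} (P : Fin n → Fin 4) : Op n := tensorOp fun j => pauli (P j)

/-- The coefficient `2 ^ (-n) Tr (P A)` of the Pauli string `P` in the operator `A`. -/
def pauliCoeff {n : ℕ} (P : Fin n → Fin 4) (A : Op n) : ℂ :=
  (pauliString P * A).trace / 2 ^ n

/-- Density matrices. -/
def IsState {n : ℕ} (ρ : Op n) : Prop := ρ.PosSemidef ∧ ρ.trace = 1

/-- The energy `Tr (ρ H)` (which is real for a Hermitian `H`). -/
def energy {n : ℕ} (ρ H : Op n) : ℝ := (ρ * H).trace.re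

/-- The operator norm with respect to the Euclidean norm on the Hilbert space. -/
def opNorm {n : ℕ} (A : Op n) : ℝ := ‖Matrix.toEuclideanCLM (𝕜 := ℂ) A‖

/-! ### Well-spread qubit states -/

/-- `π_R(s) = R† (∏ j, (1 + (-1) ^ (s j) Z_j) / 2) R` for the product unitary `R = ⨂ j, U j`. -/
def productPOVM {n : ℕ} (U : Fin n → Matrix.unitaryGroup (Fin 2) ℂ) (s : Fin n → Fin 2) : Op n :=
  (tensorOp fun j => (U j : Matrix (Fin 2) (Fin 2) ℂ)).conjTranspose *
    (tensorOp fun j => (2 : ℂ)⁻¹ • (1 + (-1 : ℂ) ^ (s j : ℕ) • pauliZ)) *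
    tensorOp fun j => (U j : Matrix (Fin 2) (Fin 2) ℂ)

/-- `p_{R,ρ}(s) = Tr (π_R(s) ρ)`. -/
def outcomeProb {n : ℕ} (U : Fin n → Matrix.unitaryGroup (Fin 2) ℂ) (ρ : Op n)
    (s : Fin n → Fin 2) : ℝ :=
  (productPOVM U s * ρ).trace.re

/-- The qubit state `ρ` is `(μ, L)`-spread. -/
def IsSpread {n : ℕ} (μ : ℝ) (L : ℕ) (ρ : Op n) : Prop :=
  ∃ (U : Fin n → Matrix.unitaryGroup (Fin 2) ℂ) (S₁ S₂ : Finset (Fin n → Fin 2)),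
    μ ≤ ∑ s ∈ S₁, outcomeProb U ρ s ∧
    μ ≤ ∑ s ∈ S₂, outcomeProb U ρ s ∧
    IsLeast {D : ℕ | ∃ s₁ ∈ S₁, ∃ s₂ ∈ S₂, D = hammingDist s₁ s₂} L

/-- Every state of energy below `ε n` is `(μ, L)`-spread for some `L ≥ c n`. -/
def WellSpreadBelow {n : ℕ} (ε μ c : ℝ) (H : Op n) : Prop :=
  ∀ ρ : Op n, IsState ρ → energy ρ H < ε * n → ∃ L : ℕ, c * n ≤ L ∧ IsSpread μ L ρ

/-! ### Fermionic modes -/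

/-- The `2 N` Majorana operators of `N` fermionic modes (Jordan-Wigner form): the operators
numbered `2 j` and `2 j + 1` (counting from zero) are `Z ⋯ Z X 1 ⋯ 1` and `Z ⋯ Z Y 1 ⋯ 1` with
`X` and `Y` at position `j`. -/
def majorana {N : ℕ} (k : Fin (2 * N)) : Op N :=
  tensorOp fun j : Fin N =>
    if (j : ℕ) < (k : ℕ) / 2 then pauliZ
    else if (j : ℕ) = (k : ℕ) / 2 then (if (k : ℕ) % 2 = 0 then pauliX else pauliY)
    else 1

/-- `C_K = i ^ (|K| (|K| - 1) / 2) c_{k_1} ⋯ c_{k_|K|}` for `K = {k_1 < ⋯ < k_|K|}`. -/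
def majoranaString {N : ℕ} (K : Finset (Fin (2 * N))) : Op N :=
  Complex.I ^ (K.card * (K.card - 1) / 2) • ((K.sort (· ≤ ·)).map majorana).prod

/-- Fermionic states: density matrices that are even polynomials in the Majorana operators. -/
def IsFermionicState {N : ℕ} (ρ : Op N) : Prop :=
  IsState ρ ∧
    ρ ∈ Submodule.span ℂ {A : Op N | ∃ K : Finset (Fin (2 * N)), Even K.card ∧ A = majoranaString K}

/-- Gaussian circuits: finite products of unitaries `exp (-ω c_k c_l)` with `k ≠ l`. -/
def gaussianCircuits (N : ℕ) : Submonoid (Op N) :=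
  Submonoid.closure {U : Op N | ∃ (k l : Fin (2 * N)) (ω : ℝ), k ≠ l ∧
    U = NormedSpace.exp (-(ω : ℂ) • (majorana k * majorana l))}

/-- `∏ j, (1 + (-1) ^ (s j) i c_{2 j} c_{2 j + 1}) / 2`, with the operators counted from zero. -/
def occupationState {N : ℕ} (s : Fin N → Fin 2) : Op N :=
  (List.ofFn fun j : Fin N => (2 : ℂ)⁻¹ • (1 + ((-1 : ℂ) ^ (s j : ℕ) * Complex.I) •
    (majorana ⟨2 * j, by omega⟩ * majorana ⟨2 * j + 1, by omega⟩))).prod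

/-- Pure Gaussian states (of either parity). -/
def IsPureGaussian {N : ℕ} (σ : Op N) : Prop :=
  ∃ G ∈ gaussianCircuits N, ∃ s : Fin N → Fin 2, σ = G * occupationState s * G.conjTranspose

/-! ### Fermionic circuits -/

/-- One layer `∏_K exp (i ω_K C_K)` over non-overlapping sets `K` with two or four elements. -/
def IsLayer {N : ℕ} (W : Op N) : Prop :=
  ∃ gates : List (Finset (Fin (2 * N)) × ℝ),
    (∀ g ∈ gates, g.1.card = 2 ∨ g.1.card = 4) ∧
    gates.Pairwise (fun g h => Disjoint g.1 h.1) ∧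
    W = (gates.map fun g =>
      NormedSpace.exp ((Complex.I * (g.2 : ℂ)) • majoranaString g.1)).prod

/-- Fermionic circuits `W_T ⋯ W_1` of depth `T`. -/
def IsCircuit {N : ℕ} : ℕ → Op N → Prop
  | 0, U => U = 1
  | T + 1, U => ∃ W V : Op N, IsLayer W ∧ IsCircuit T V ∧ U = W * V

/-- Depth `T` circuits `G_T W_T ⋯ G_1 W_1` with free access to Gaussian operations. -/
def IsGaussianAssistedCircuit {N : ℕ} : ℕ → Op N → Prop
  | 0, U => U = 1
  | T + 1, U => ∃ G W V : Op N, G ∈ gaussianCircuits N ∧ IsLayer W ∧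
      IsGaussianAssistedCircuit T V ∧ U = G * W * V

/-- The trace over the last `m` of `N + m` modes. As the first `2 N` of the `2 (N + m)` Majorana
operators act as the `2 N` Majorana operators of `N` modes, tensored with the identity, it sends
`C_K` to `2 ^ m C_K` if `K` consists of some of the first `2 N` indices and to `0` otherwise. -/
def traceAncillas {N : ℕ} (m : ℕ) (A : Op (N + m)) : Op N :=
  Matrix.of fun s t => ∑ u : Fin m → Fin 2, A (Fin.append s u) (Fin.append t u)

/-- `ρ` is prepared, up to tracing out `m` ancillary modes, by a fermionic circuit of depth `T`
from a pure Gaussian state. -/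
def Prepares {N : ℕ} (m T : ℕ) (ρ : Op N) : Prop :=
  ∃ U σ : Op (N + m), IsCircuit T U ∧ IsPureGaussian σ ∧
    ρ = traceAncillas m (U * σ * U.conjTranspose)

/-- The same for circuits with free access to Gaussian operations. -/
def PreparesGaussianAssisted {N : ℕ} (m T : ℕ) (ρ : Op N) : Prop :=
  ∃ U σ : Op (N + m), IsGaussianAssistedCircuit T U ∧ IsPureGaussian σ ∧
    ρ = traceAncillas m (U * σ * U.conjTranspose)

/-! ### The fermionic Hamiltonian -/

/-- The replacements `X_j ↦ i c_{y,j} c_{z,j}`, `Y_j ↦ i c_{x,j} c_{z,j}`, `Z_j ↦ i c_{x,j} c_{y,j}`.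
The bijection `e` labels the Majorana operators: `e (j, 0)`, `e (j, 1)`, `e (j, 2)` are the numbers
of `c_{x,j}`, `c_{y,j}`, `c_{z,j}`. -/
def pauliImage {n N : ℕ} (e : Fin n × Fin 3 ≃ Fin (2 * N)) (j : Fin n) : Fin 4 → Op N :=
  ![1,
    Complex.I • (majorana (e (j, 1)) * majorana (e (j, 2))),
    Complex.I • (majorana (e (j, 0)) * majorana (e (j, 2))),
    Complex.I • (majorana (e (j, 0)) * majorana (e (j, 1)))]

/-- The fermionic operator obtained by making these replacements in the expansion of `A` in
products of Pauli operators. -/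
def toFermions {n N : ℕ} (e : Fin n × Fin 3 ≃ Fin (2 * N)) (A : Op n) : Op N :=
  ∑ P : Fin n → Fin 4, pauliCoeff P A • (List.ofFn fun j => pauliImage e j (P j)).prod

/-! ### Local sparse Hamiltonians -/

/-- `H ≥ 0` is a sum of Hermitian terms of operator norm at most one, each acting on at most `k`
qubits, such that each qubit is acted on by at most `d` terms. -/
def IsLocalSparseQubit {n : ℕ} (k d : ℕ) (H : Op n) : Prop :=
  H.PosSemidef ∧ ∃ (r : ℕ) (h : Fin r → Op n) (S : Fin r → Finset (Fin n)),
    H = ∑ i, h i ∧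
    (∀ i, (h i).IsHermitian ∧ opNorm (h i) ≤ 1 ∧ (S i).card ≤ k ∧
      h i ∈ Submodule.span ℂ
        {A : Op n | ∃ P : Fin n → Fin 4, (∀ j, j ∉ S i → P j = 0) ∧ A = pauliString P}) ∧
    ∀ j, (Finset.univ.filter fun i => j ∈ S i).card ≤ d

/-- `H ≥ 0` is a sum of Hermitian terms of operator norm at most one, each an even polynomial in
at most `k` Majorana operators, such that each Majorana operator is involved in at most `d`
terms. -/
def IsLocalSparseFermionic {N : ℕ} (k d : ℕ) (H : Op N) : Prop :=
  H.PosSemidef ∧ ∃ (r : ℕ) (h : Fin r → Op N) (S : Fin r → Finset (Fin (2 * N))),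
    H = ∑ i, h i ∧
    (∀ i, (h i).IsHermitian ∧ opNorm (h i) ≤ 1 ∧ (S i).card ≤ k ∧
      h i ∈ Submodule.span ℂ
        {A : Op N | ∃ K : Finset (Fin (2 * N)), K ⊆ S i ∧ Even K.card ∧ A = majoranaString K}) ∧
    ∀ l, (Finset.univ.filter fun i => l ∈ S i).card ≤ d

end FNLTS

end

open scoped ComplexOrder

noncomputable section

namespace FNLTS

/-! ### Majorana operators and their ordered products. -/

section

/-! ### Tensor products of single-site operators -/

/-! Replacing the Pauli matrices of each site by products of two of its three Majorana operators is
a unital star homomorphism `toFermionsHom`. It preserves positivity, does not increase norms and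
respects locality, which settles the claim on local sparse Hamiltonians. Dually, a fermionic state ρ
yields a qubit state `qubitState e ρ` with the same energy. A low-energy ρ therefore inherits spread
outcomes: the images P₁, P₂ of the projections onto two outcome sets at Hamming distance L both have
probability at least μ.

It remains to see that shallow circuits cannot produce such a state UσU†. A pure Gaussian σ is the
vacuum of annihilation operators that are linear in the Majorana operators. The projections Qᵢ =
U†PᵢU involve only the Majorana operators in a set S: a light cone of size at most 5^T · 2N for
plain circuits, or all 2(N + m) of them if Gaussian operations are free. By `IsCAR.exists_reduction`
there are r ≤ |S| modes, still annihilating σ, whose algebra contains the Qᵢ. On the space this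
algebra generates from σ, their number operator H has eigenvalues in {0, …, r}, and only multiples
of σ belong to 0. If f is a rescaled Chebyshev polynomial of degree at most l with f(0) = 1 and |f|
≤ η = 1/(1 + 2l²/R) on [1, R], where R ≥ |S|, then f(H) is an approximate projection onto σ.

On the other hand H is quadratic, and conjugation by U multiplies degrees by at most 5^T, also with
Gaussian circuits in between, since these preserve degree. So U f(H) U† has degree at most 5^T · 2l.
One Majorana operator touches at most one site, so it changes a measured bitstring in at most one
place (`embed_povm_mul_mul_eq_zero`), and P₁ U f(H) U† P₂ = 0 once 5^T · 2l < L. This forces Tr(Q₁σ)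
Tr(Q₂σ) ≤ η² (`mul_le_sq_of_mul_aeval_mul_eq_zero`), hence μ ≤ η (`spread_bound`). With l of order
n/5^T and R of order n · 5^T this reads n = O(125^T), a logarithmic bound on the depth
(`depth_bound`). -/

theorem tensorOp_mul {n : ℕ} (A B : Fin n → Matrix (Fin 2) (Fin 2) ℂ) :
    tensorOp A * tensorOp B = tensorOp fun j => A j * B j := by
  ext s t
  simp only [tensorOp, Matrix.mul_apply, Matrix.of_apply]
  rw [Finset.prod_univ_sum, Fintype.piFinset_univ]
  simp only [Finset.prod_mul_distrib]

theorem tensorOp_one {n : ℕ} : tensorOp (fun _ : Fin n => 1) = 1 := by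
  ext s t
  simp only [tensorOp, Matrix.of_apply, Matrix.one_apply]
  rw [Finset.prod_ite_zero]
  simp [funext_iff]

theorem tensorOp_conjTranspose {n : ℕ} (A : Fin n → Matrix (Fin 2) (Fin 2) ℂ) :
    (tensorOp A).conjTranspose = tensorOp fun j => (A j).conjTranspose := by
  ext s t
  simp [tensorOp, Matrix.conjTranspose_apply]

theorem tensorOp_anticomm {n : ℕ} {A B : Fin n → Matrix (Fin 2) (Fin 2) ℂ} (i : Fin n)
    (hi : A i * B i = -(B i * A i)) (h : ∀ j, j ≠ i → A j * B j = B j * A j) :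
    tensorOp A * tensorOp B = -(tensorOp B * tensorOp A) := by
  rw [tensorOp_mul, tensorOp_mul]
  ext s t
  simp only [tensorOp, Matrix.of_apply, Matrix.neg_apply]
  rw [← Finset.mul_prod_erase _ _ (Finset.mem_univ i), hi,
    ← Finset.mul_prod_erase _ _ (Finset.mem_univ i), Matrix.neg_apply, neg_mul]
  congr 2
  exact Finset.prod_congr rfl fun j hj => by rw [h j (Finset.ne_of_mem_erase hj)]

theorem tensorOp_single {n : ℕ} (s t : Fin n → Fin 2) :
    tensorOp (fun j => Matrix.single (s j) (t j) (1 : ℂ)) = Matrix.single s t 1 := by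
  ext a b
  simp only [tensorOp, Matrix.of_apply, Matrix.single_apply]
  rw [Finset.prod_ite_zero]
  simp [funext_iff, forall_and]

/-! ### Pauli matrices -/

theorem pauliX_mul_self : pauliX * pauliX = 1 := by
  ext i j; fin_cases i <;> fin_cases j <;> simp [pauliX]

theorem pauliY_mul_self : pauliY * pauliY = 1 := by
  ext i j; fin_cases i <;> fin_cases j <;> simp [pauliY]

theorem pauliZ_mul_self : pauliZ * pauliZ = 1 := by
  ext i j; fin_cases i <;> fin_cases j <;> simp [pauliZ]

theorem pauliX_mul_pauliY : pauliX * pauliY = -(pauliY * pauliX) := by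
  ext i j; fin_cases i <;> fin_cases j <;> simp [pauliX, pauliY]

theorem pauliX_mul_pauliZ : pauliX * pauliZ = -(pauliZ * pauliX) := by
  ext i j; fin_cases i <;> fin_cases j <;> simp [pauliX, pauliZ]

theorem pauliY_mul_pauliZ : pauliY * pauliZ = -(pauliZ * pauliY) := by
  ext i j; fin_cases i <;> fin_cases j <;> simp [pauliY, pauliZ]

theorem pauliX_conjTranspose : pauliX.conjTranspose = pauliX := by
  ext i j; fin_cases i <;> fin_cases j <;> simp [pauliX]

theorem pauliY_conjTranspose : pauliY.conjTranspose = pauliY := by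
  ext i j; fin_cases i <;> fin_cases j <;> simp [pauliY]

theorem pauliZ_conjTranspose : pauliZ.conjTranspose = pauliZ := by
  ext i j; fin_cases i <;> fin_cases j <;> simp [pauliZ]

/-! ### Majorana operators -/

variable {N : ℕ}

theorem majorana_mul_self (k : Fin (2 * N)) : majorana k * majorana k = 1 := by
  rw [majorana, tensorOp_mul, ← tensorOp_one]
  congr 1
  funext j
  split_ifs <;> simp [pauliX_mul_self, pauliY_mul_self, pauliZ_mul_self]

theorem majorana_conjTranspose (k : Fin (2 * N)) : (majorana k).conjTranspose = majorana k := by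
  rw [majorana, tensorOp_conjTranspose]
  congr 1
  funext j
  split_ifs <;> simp [pauliX_conjTranspose, pauliY_conjTranspose, pauliZ_conjTranspose]

theorem star_majorana (k : Fin (2 * N)) : star (majorana k) = majorana k :=
  majorana_conjTranspose k

theorem majorana_anticomm {k l : Fin (2 * N)} (h : k ≠ l) :
    majorana k * majorana l = -(majorana l * majorana k) := by
  wlog hkl : k < l generalizing k l
  · rw [this h.symm (lt_of_le_of_ne (not_lt.1 hkl) h.symm), neg_neg]
  have hkl' : (k : ℕ) < l := hkl
  have hk := k.2
  refine tensorOp_anticomm ⟨(k : ℕ) / 2, by omega⟩ ?_ ?_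
  · rcases lt_or_eq_of_le (show (k : ℕ) / 2 ≤ (l : ℕ) / 2 by omega) with hlt | heq
    · rcases Nat.mod_two_eq_zero_or_one (k : ℕ) with h0 | h0 <;>
        simp [hlt, h0, pauliX_mul_pauliZ, pauliY_mul_pauliZ]
    · have h0 : (k : ℕ) % 2 = 0 := by omega
      have h1 : (l : ℕ) % 2 = 1 := by omega
      simp [← heq, h0, h1, pauliX_mul_pauliY]
  · intro j hj
    have hj' : (j : ℕ) ≠ (k : ℕ) / 2 := fun h' => hj (Fin.ext h')
    rcases lt_or_gt_of_ne hj' with h1 | h1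
    · have h2 : (j : ℕ) < (l : ℕ) / 2 := by omega
      simp [h1, h2]
    · simp [h1.not_gt, hj']

/-! ### Products of Majorana operators -/

/-- The product of the Majorana operators with the indices in a list. -/
def word (l : List (Fin (2 * N))) : Op N := (l.map majorana).prod

@[simp] theorem word_nil : word ([] : List (Fin (2 * N))) = 1 := rfl

@[simp] theorem word_cons (k : Fin (2 * N)) (l) : word (k :: l) = majorana k * word l := by
  simp [word]

theorem word_append (l l' : List (Fin (2 * N))) : word (l ++ l') = word l * word l' := by
  simp [word]

theorem majorana_mul_word {k : Fin (2 * N)} {l : List (Fin (2 * N))} (h : k ∉ l) :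
    majorana k * word l = (-1 : ℂ) ^ l.length • (word l * majorana k) := by
  induction l with
  | nil => simp
  | cons a l ih =>
    simp only [List.mem_cons, not_or] at h
    rw [word_cons, ← mul_assoc, majorana_anticomm h.1, neg_mul, mul_assoc, ih h.2,
      mul_smul_comm, List.length_cons, pow_succ, mul_neg_one, neg_smul, mul_assoc]

theorem word_perm {l l' : List (Fin (2 * N))} (h : l.Perm l') :
    word l = word l' ∨ word l = -word l' := by
  induction h with
  | nil => simp
  | cons a _ ih => rcases ih with h | h <;> simp [h]
  | swap a b l =>
    by_cases hab : a = b
    · simp [hab]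
    · right
      simp only [word_cons, ← mul_assoc, majorana_anticomm (Ne.symm hab), neg_mul]
  | trans _ _ h1 h2 => rcases h1 with h1 | h1 <;> rcases h2 with h2 | h2 <;> simp [h1, h2]

theorem star_word (l : List (Fin (2 * N))) : star (word l) = word l.reverse := by
  induction l with
  | nil => simp
  | cons a l ih => simp [word_append, star_mul, ih, star_majorana]

theorem word_mul_word_reverse (l : List (Fin (2 * N))) : word l * word l.reverse = 1 := by
  induction l with
  | nil => simp
  | cons a l ih =>
    rw [List.reverse_cons, word_append, word_cons, mul_assoc, ← mul_assoc (word l), ih]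
    simp [majorana_mul_self]

/-- Every pair of distinct factors is exchanged once. The resulting sign is what the phase in
`majoranaString` compensates, so that these strings are Hermitian with square one. -/
theorem word_reverse {l : List (Fin (2 * N))} (h : l.Nodup) :
    word l.reverse = (-1 : ℂ) ^ (l.length * (l.length - 1) / 2) • word l := by
  induction l with
  | nil => simp
  | cons a l ih =>
    rw [List.nodup_cons] at h
    rw [List.reverse_cons, word_append, ih h.2, word_cons, word_nil, mul_one, word_cons,
      majorana_mul_word h.1, List.length_cons, Nat.triangle_succ, pow_add, smul_smul, mul_assoc, ← pow_add,
      Even.neg_one_pow ⟨l.length, rfl⟩]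
    simp

theorem majoranaString_eq (K : Finset (Fin (2 * N))) :
    majoranaString K = Complex.I ^ (K.card * (K.card - 1) / 2) • word (K.sort (· ≤ ·)) := rfl

theorem word_sort_eq (K : Finset (Fin (2 * N))) :
    ∃ z : ℂ, word (K.sort (· ≤ ·)) = z • majoranaString K :=
  ⟨(Complex.I ^ (K.card * (K.card - 1) / 2))⁻¹, by
    rw [majoranaString_eq, smul_smul, inv_mul_cancel₀ (pow_ne_zero _ Complex.I_ne_zero), one_smul]⟩

theorem star_majoranaString (K : Finset (Fin (2 * N))) :
    star (majoranaString K) = majoranaString K := by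
  rw [majoranaString_eq, star_smul, star_word, word_reverse (Finset.sort_nodup _ _), smul_smul,
    Finset.length_sort]
  congr 1
  rw [star_pow, ← mul_pow]
  simp

theorem majoranaString_mul_self (K : Finset (Fin (2 * N))) :
    majoranaString K * majoranaString K = 1 := by
  nth_rw 2 [← star_majoranaString]
  rw [majoranaString_eq, star_smul, star_word, smul_mul_smul_comm, word_mul_word_reverse,
    star_pow, ← mul_pow]
  simp

theorem majorana_comm_majoranaString {K : Finset (Fin (2 * N))} (hK : Even K.card)
    {k : Fin (2 * N)} (hk : k ∉ K) : Commute (majorana k) (majoranaString K) := by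
  rw [majoranaString_eq]
  refine Commute.smul_right ?_ _
  rw [commute_iff_eq, majorana_mul_word (by simpa using hk)]
  simp [hK.neg_one_pow]

theorem sort_perm_cons_erase {K : Finset (Fin (2 * N))} {k : Fin (2 * N)} (hk : k ∈ K) :
    (K.sort (· ≤ ·)).Perm (k :: (K.erase k).sort (· ≤ ·)) := by
  rw [List.perm_ext_iff_of_nodup (Finset.sort_nodup _ _)
    (by simp [List.nodup_cons, Finset.sort_nodup])]
  intro a
  by_cases ha : a = k <;> simp [ha, hk]

theorem sort_insert_perm {K : Finset (Fin (2 * N))} {k : Fin (2 * N)} (hk : k ∉ K) :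
    ((insert k K).sort (· ≤ ·)).Perm (k :: K.sort (· ≤ ·)) := by
  have := sort_perm_cons_erase (Finset.mem_insert_self k K)
  rwa [Finset.erase_insert hk] at this

/-- The operator commutes with its own copy in the string and anticommutes with the remaining
factors, whose number is odd. -/
theorem majorana_anticomm_majoranaString {K : Finset (Fin (2 * N))} (hK : Even K.card)
    {k : Fin (2 * N)} (hk : k ∈ K) :
    majorana k * majoranaString K = -(majoranaString K * majorana k) := by
  have key : majorana k * word (K.sort (· ≤ ·)) = -(word (K.sort (· ≤ ·)) * majorana k) := by
    have h1 : majorana k * word (k :: (K.erase k).sort (· ≤ ·)) =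
        -(word (k :: (K.erase k).sort (· ≤ ·)) * majorana k) := by
      have hodd : Odd ((K.erase k).sort (· ≤ ·)).length := by
        rw [Finset.length_sort, Finset.card_erase_of_mem hk]
        exact Nat.Even.sub_odd (Finset.card_pos.2 ⟨k, hk⟩) hK odd_one
      rw [word_cons, mul_assoc (majorana k) _ (majorana k)]
      have h2 := majorana_mul_word (k := k) (l := (K.erase k).sort (· ≤ ·)) (by simp)
      rw [hodd.neg_one_pow, neg_one_smul] at h2
      nth_rw 1 [h2]
      rw [mul_neg]
    rcases word_perm (sort_perm_cons_erase hk) with h | h <;> rw [h]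
    · exact h1
    · rw [mul_neg, h1]; simp
  rw [majoranaString_eq, mul_smul_comm, key, smul_mul_assoc, smul_neg]

/-- The span of the even Majorana strings with indices in `S`. -/
def evenSpan (S : Finset (Fin (2 * N))) : Submodule ℂ (Op N) :=
  Submodule.span ℂ {A : Op N | ∃ K : Finset (Fin (2 * N)), K ⊆ S ∧ Even K.card ∧
    A = majoranaString K}

theorem majorana_mul_majoranaString (k : Fin (2 * N)) (K : Finset (Fin (2 * N))) :
    ∃ (z : ℂ) (K' : Finset (Fin (2 * N))), K' ⊆ insert k K ∧ (Even K'.card ↔ ¬ Even K.card) ∧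
      majorana k * majoranaString K = z • majoranaString K' := by
  by_cases hk : k ∈ K
  · have h1 : majorana k * word (k :: (K.erase k).sort (· ≤ ·)) =
      word ((K.erase k).sort (· ≤ ·)) := by
      rw [word_cons, ← mul_assoc, majorana_mul_self, one_mul]
    have h2 : ∃ z : ℂ, majorana k * majoranaString K = z • majoranaString (K.erase k) := by
      obtain ⟨z, hz⟩ := word_sort_eq (K.erase k)
      rw [majoranaString_eq K]
      rcases word_perm (sort_perm_cons_erase hk) with h | h
      · exact ⟨_, by rw [h, mul_smul_comm, h1, hz, smul_smul]⟩
      · exact ⟨_, by rw [h, mul_smul_comm, mul_neg, h1, hz, ← neg_smul, smul_smul]⟩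
    obtain ⟨z, hz⟩ := h2
    refine ⟨z, K.erase k, (Finset.erase_subset _ _).trans (Finset.subset_insert _ _), ?_, hz⟩
    rw [← Finset.card_erase_add_one hk, Nat.even_add_one, not_not]
  · have h2 : ∃ z : ℂ, majorana k * majoranaString K = z • majoranaString (insert k K) := by
      obtain ⟨z, hz⟩ := word_sort_eq (insert k K)
      rw [majoranaString_eq K, mul_smul_comm, ← word_cons]
      rcases word_perm (sort_insert_perm hk).symm with h | h
      · exact ⟨_, by rw [h, hz, smul_smul]⟩
      · exact ⟨_, by rw [h, hz, ← neg_smul, smul_smul]⟩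
    obtain ⟨z, hz⟩ := h2
    refine ⟨z, insert k K, subset_rfl, ?_, hz⟩
    rw [Finset.card_insert_of_notMem hk, Nat.even_add_one]

theorem one_mem_evenSpan (S : Finset (Fin (2 * N))) : (1 : Op N) ∈ evenSpan S :=
  Submodule.subset_span ⟨∅, by simp [majoranaString]⟩

theorem majorana_mul_majorana_mul_mem_evenSpan {S : Finset (Fin (2 * N))} {k l : Fin (2 * N)}
    (hk : k ∈ S) (hl : l ∈ S) {A : Op N} (hA : A ∈ evenSpan S) :
    majorana k * majorana l * A ∈ evenSpan S := by
  induction hA using Submodule.span_induction with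
  | mem A hA =>
    obtain ⟨K, hKS, hK, rfl⟩ := hA
    obtain ⟨z, K', h1, h2, h3⟩ := majorana_mul_majoranaString l K
    obtain ⟨z', K'', h1', h2', h3'⟩ := majorana_mul_majoranaString k K'
    rw [mul_assoc, h3, mul_smul_comm, h3']
    refine Submodule.smul_mem _ _ (Submodule.smul_mem _ _ (Submodule.subset_span
      ⟨K'', ?_, by tauto, rfl⟩))
    intro a ha
    rcases Finset.mem_insert.1 (h1' ha) with rfl | ha
    · exact hk
    · rcases Finset.mem_insert.1 (h1 ha) with rfl | ha
      · exact hl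
      · exact hKS ha
  | zero => simp
  | add A B _ _ hA hB => rw [mul_add]; exact add_mem hA hB
  | smul z A _ hA => rw [mul_smul_comm]; exact Submodule.smul_mem _ _ hA

end

/-! ### The star homomorphism from qubit operators to fermionic operators. -/

section

/-! ### The single-site embeddings -/

/-- The phase of the product of two Pauli matrices. -/
def pauliPhase : Fin 4 → Fin 4 → ℂ :=
  ![![1, 1, 1, 1], ![1, 1, Complex.I, -Complex.I], ![1, -Complex.I, 1, Complex.I],
    ![1, Complex.I, -Complex.I, 1]]

/-- The label of the product of two Pauli matrices. -/
def pauliIndex : Fin 4 → Fin 4 → Fin 4 :=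
  ![![0, 1, 2, 3], ![1, 0, 3, 2], ![2, 3, 0, 1], ![3, 2, 1, 0]]

/-- Used both for the Pauli matrices and for their Majorana images: the two share one table of
structure constants, which makes the replacement multiplicative on a site. -/
theorem pauli_table {R : Type*} [Ring R] [Algebra ℂ R] {x y z : R} (hx : x * x = 1)
    (hy : y * y = 1) (hz : z * z = 1) (hxy : x * y = Complex.I • z) (hyx : y * x = -(Complex.I • z))
    (hyz : y * z = Complex.I • x) (hzy : z * y = -(Complex.I • x)) (hzx : z * x = Complex.I • y)
    (hxz : x * z = -(Complex.I • y)) (p q : Fin 4) :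
    (![1, x, y, z] : Fin 4 → R) p * (![1, x, y, z] : Fin 4 → R) q =
      pauliPhase p q • (![1, x, y, z] : Fin 4 → R) (pauliIndex p q) := by
  fin_cases p <;> fin_cases q <;> simp [pauliPhase, pauliIndex, *]

theorem pauli_mul_pauli (p q : Fin 4) :
    pauli p * pauli q = pauliPhase p q • pauli (pauliIndex p q) := by
  refine pauli_table pauliX_mul_self pauliY_mul_self pauliZ_mul_self ?_ ?_ ?_ ?_ ?_ ?_ p q <;>
  · ext i j
    fin_cases i <;> fin_cases j <;> simp [pauliX, pauliY, pauliZ]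

theorem pauli_conjTranspose (p : Fin 4) : (pauli p).conjTranspose = pauli p := by
  fin_cases p <;> simp [pauli, pauliX_conjTranspose, pauliY_conjTranspose, pauliZ_conjTranspose]

/-- The coefficient of a Pauli matrix in a single-site operator. -/
def siteCoeff (p : Fin 4) : Matrix (Fin 2) (Fin 2) ℂ →ₗ[ℂ] ℂ :=
  (2 : ℂ)⁻¹ • (Matrix.traceLinearMap (Fin 2) ℂ ℂ ∘ₗ LinearMap.mulLeft ℂ (pauli p))

theorem siteCoeff_apply (p : Fin 4) (A : Matrix (Fin 2) (Fin 2) ℂ) :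
    siteCoeff p A = (pauli p * A).trace / 2 := by
  simp [siteCoeff, div_eq_inv_mul]

theorem siteCoeff_pauli (p q : Fin 4) : siteCoeff p (pauli q) = if q = p then 1 else 0 := by
  rw [siteCoeff_apply]
  fin_cases p <;> fin_cases q <;>
    simp [pauli, pauliX, pauliY, pauliZ, Matrix.trace]

theorem sum_siteCoeff_smul_pauli (A : Matrix (Fin 2) (Fin 2) ℂ) :
    ∑ p, siteCoeff p A • pauli p = A := by
  ext i j
  simp only [siteCoeff_apply]
  fin_cases i <;> fin_cases j <;>
    simp [Fin.sum_univ_four, pauli, pauliX, pauliY, pauliZ, Matrix.trace, Matrix.mul_apply] <;>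
    ring_nf <;> simp <;> ring

theorem siteCoeff_star (p : Fin 4) (A : Matrix (Fin 2) (Fin 2) ℂ) :
    siteCoeff p (star A) = star (siteCoeff p A) := by
  rw [siteCoeff_apply, siteCoeff_apply, Matrix.star_eq_conjTranspose]
  nth_rw 1 [← pauli_conjTranspose p]
  rw [← Matrix.conjTranspose_mul, Matrix.trace_conjTranspose, Matrix.trace_mul_comm]
  simp

variable {n N : ℕ} (e : Fin n × Fin 3 ≃ Fin (2 * N))

theorem majorana_mul_left_anticomm {k l : Fin (2 * N)} (h : k ≠ l) (A : Op N) :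
    majorana k * (majorana l * A) = -(majorana l * (majorana k * A)) := by
  rw [← mul_assoc, majorana_anticomm h, neg_mul, mul_assoc]

theorem majorana_mul_left_self (k : Fin (2 * N)) (A : Op N) :
    majorana k * (majorana k * A) = A := by
  rw [← mul_assoc, majorana_mul_self, one_mul]

theorem pauliImage_mul (j : Fin n) (p q : Fin 4) :
    pauliImage e j p * pauliImage e j q =
      pauliPhase p q • pauliImage e j (pauliIndex p q) := by
  have h01 : e (j, 1) ≠ e (j, 0) := by simp
  have h02 : e (j, 2) ≠ e (j, 0) := by simp
  have h12 : e (j, 2) ≠ e (j, 1) := by simp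
  refine pauli_table ?_ ?_ ?_ ?_ ?_ ?_ ?_ ?_ ?_ p q <;>
  · simp only [smul_mul_smul_comm, Complex.I_mul_I, mul_assoc, majorana_mul_left_anticomm h01,
      majorana_mul_left_anticomm h02, majorana_mul_left_anticomm h12, majorana_anticomm h01,
      majorana_anticomm h12, majorana_mul_self, majorana_mul_left_self,
      mul_neg, mul_one, smul_smul, neg_smul, smul_neg, one_smul, neg_neg]

theorem star_pauliImage (j : Fin n) (p : Fin 4) : star (pauliImage e j p) = pauliImage e j p := by
  have h01 : e (j, 1) ≠ e (j, 0) := by simp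
  have h02 : e (j, 2) ≠ e (j, 0) := by simp
  have h12 : e (j, 2) ≠ e (j, 1) := by simp
  fin_cases p <;>
    simp [pauliImage, star_smul, star_mul, star_majorana, majorana_anticomm h01,
      majorana_anticomm h02, majorana_anticomm h12]

/-- The image is even, so passing a foreign Majorana operator costs two signs. This is why images of
different sites commute, as qubit operators must. -/
theorem pauliImage_commute_majorana (j : Fin n) (p : Fin 4) {k : Fin (2 * N)}
    (hk : ∀ a, k ≠ e (j, a)) : Commute (pauliImage e j p) (majorana k) := by
  have h : ∀ a b, Commute (majorana (e (j, a)) * majorana (e (j, b))) (majorana k) := by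
    intro a b
    rw [commute_iff_eq, mul_assoc, majorana_anticomm (hk b).symm, mul_neg, ← mul_assoc,
      majorana_anticomm (hk a).symm, neg_mul, neg_neg, mul_assoc]
  fin_cases p
  · exact Commute.one_left _
  · exact (h 1 2).smul_left _
  · exact (h 0 2).smul_left _
  · exact (h 0 1).smul_left _

/-- The embedding of the operators on site `j`. -/
def siteMap (j : Fin n) : Matrix (Fin 2) (Fin 2) ℂ →ₗ[ℂ] Op N :=
  ∑ p, (siteCoeff p).smulRight (pauliImage e j p)

theorem siteMap_apply (j : Fin n) (A : Matrix (Fin 2) (Fin 2) ℂ) :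
    siteMap e j A = ∑ p, siteCoeff p A • pauliImage e j p := by
  simp [siteMap]

theorem siteMap_pauli (j : Fin n) (p : Fin 4) : siteMap e j (pauli p) = pauliImage e j p := by
  simp [siteMap_apply, siteCoeff_pauli]

theorem siteMap_one (j : Fin n) : siteMap e j 1 = 1 := siteMap_pauli e j 0

theorem siteMap_mul (j : Fin n) (A B : Matrix (Fin 2) (Fin 2) ℂ) :
    siteMap e j (A * B) = siteMap e j A * siteMap e j B := by
  nth_rw 1 [← sum_siteCoeff_smul_pauli A, ← sum_siteCoeff_smul_pauli B]
  rw [siteMap_apply e j A, siteMap_apply e j B]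
  simp only [Finset.sum_mul_sum, map_sum, smul_mul_smul_comm, map_smul, pauli_mul_pauli,
    siteMap_pauli, pauliImage_mul]

theorem siteMap_star (j : Fin n) (A : Matrix (Fin 2) (Fin 2) ℂ) :
    siteMap e j (star A) = star (siteMap e j A) := by
  simp only [siteMap_apply, siteCoeff_star, star_sum, star_smul, star_pauliImage]

theorem siteMap_commute_majorana (j : Fin n) (A : Matrix (Fin 2) (Fin 2) ℂ) {k : Fin (2 * N)}
    (hk : ∀ a, k ≠ e (j, a)) : Commute (siteMap e j A) (majorana k) := by
  rw [siteMap_apply]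
  exact Commute.sum_left _ _ _ fun p _ => (pauliImage_commute_majorana e j p hk).smul_left _

theorem pauliImage_commute_of_commute {j : Fin n} {A : Op N}
    (h : ∀ a, Commute A (majorana (e (j, a)))) (p : Fin 4) : Commute A (pauliImage e j p) := by
  fin_cases p
  · exact Commute.one_right _
  · exact ((h 1).mul_right (h 2)).smul_right _
  · exact ((h 0).mul_right (h 2)).smul_right _
  · exact ((h 0).mul_right (h 1)).smul_right _

theorem siteMap_commute {i j : Fin n} (h : i ≠ j) (A B : Matrix (Fin 2) (Fin 2) ℂ) :
    Commute (siteMap e i A) (siteMap e j B) := by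
  rw [siteMap_apply e j]
  refine Commute.sum_right _ _ _ fun p _ => Commute.smul_right ?_ _
  refine pauliImage_commute_of_commute e (fun a => siteMap_commute_majorana e i A ?_) p
  simp [h.symm]

/-! ### The embedding of all operators -/

theorem prod_ofFn_mul_prod_ofFn {R : Type*} [Monoid R] {n : ℕ} (f g : Fin n → R)
    (h : ∀ i j, i ≠ j → Commute (f i) (g j)) :
    (List.ofFn f).prod * (List.ofFn g).prod = (List.ofFn fun i => f i * g i).prod := by
  induction n with
  | zero => simp
  | succ n ih =>
    simp only [List.ofFn_succ, List.prod_cons]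
    rw [← ih _ _ fun i j hij => h _ _ (by simpa using hij)]
    have hc : Commute (List.ofFn fun i : Fin n => f i.succ).prod (g 0) := by
      refine Commute.list_prod_left _ _ fun a ha => ?_
      obtain ⟨i, rfl⟩ := (List.mem_ofFn' _ _).1 ha
      exact h _ _ (Fin.succ_ne_zero i)
    rw [mul_assoc, ← mul_assoc _ (g 0), hc.eq]
    simp only [mul_assoc]

theorem star_prod_ofFn {R : Type*} [Monoid R] [StarMul R] {n : ℕ} (f : Fin n → R)
    (h : ∀ i j, i ≠ j → Commute (f i) (f j)) :
    star (List.ofFn f).prod = (List.ofFn fun i => star (f i)).prod := by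
  induction n with
  | zero => simp
  | succ n ih =>
    simp only [List.ofFn_succ, List.prod_cons]
    rw [star_mul, ← ih _ fun i j hij => h _ _ (by simpa using hij), ← star_mul, ← star_mul]
    congr 1
    have hc : Commute (f 0) (List.ofFn fun i : Fin n => f i.succ).prod := by
      refine Commute.list_prod_right _ _ fun a ha => ?_
      obtain ⟨i, rfl⟩ := (List.mem_ofFn' _ _).1 ha
      exact h _ _ (Fin.succ_ne_zero i).symm
    exact hc.eq

theorem tensorOp_trace (A : Fin n → Matrix (Fin 2) (Fin 2) ℂ) :
    (tensorOp A).trace = ∏ j, (A j).trace := by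
  simp only [Matrix.trace, Matrix.diag_apply, tensorOp, Matrix.of_apply]
  rw [Finset.prod_univ_sum, Fintype.piFinset_univ]

theorem pauliCoeff_tensorOp (P : Fin n → Fin 4) (A : Fin n → Matrix (Fin 2) (Fin 2) ℂ) :
    pauliCoeff P (tensorOp A) = ∏ j, siteCoeff (P j) (A j) := by
  simp [pauliCoeff, pauliString, tensorOp_mul, tensorOp_trace, siteCoeff_apply,
    Finset.prod_div_distrib]

/-- Expanding the ordered product of the site images by multilinearity reproduces the sum over Pauli
strings. -/
theorem toFermions_tensorOp (A : Fin n → Matrix (Fin 2) (Fin 2) ℂ) :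
    toFermions e (tensorOp A) = (List.ofFn fun j => siteMap e j (A j)).prod := by
  have h := (MultilinearMap.mkPiAlgebraFin ℂ n (Op N)).map_sum
    (fun j p => siteCoeff p (A j) • pauliImage e j p)
  simp only [MultilinearMap.mkPiAlgebraFin_apply] at h
  simp only [siteMap_apply, h, toFermions, pauliCoeff_tensorOp]
  refine Finset.sum_congr rfl fun P _ => ?_
  have h2 := (MultilinearMap.mkPiAlgebraFin ℂ n (Op N)).map_smul_univ
    (fun j => siteCoeff (P j) (A j)) (fun j => pauliImage e j (P j))
  simp only [MultilinearMap.mkPiAlgebraFin_apply] at h2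
  exact h2.symm

theorem span_range_tensorOp : Submodule.span ℂ (Set.range (tensorOp (n := n))) = ⊤ := by
  rw [eq_top_iff]
  intro A _
  rw [Matrix.matrix_eq_sum_single A]
  refine sum_mem fun s _ => sum_mem fun t _ => ?_
  have : Matrix.single s t (A s t) = A s t • Matrix.single s t (1 : ℂ) := by simp
  rw [this, ← tensorOp_single]
  exact Submodule.smul_mem _ _ (Submodule.subset_span ⟨_, rfl⟩)

/-- `toFermions` as a linear map. -/
def toFermionsLinear : Op n →ₗ[ℂ] Op N where
  toFun := toFermions e
  map_add' A B := by
    simp [toFermions, pauliCoeff, mul_add, add_div, add_smul, Finset.sum_add_distrib]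
  map_smul' z A := by
    simp [toFermions, pauliCoeff, Finset.smul_sum, smul_smul, mul_div_assoc]

theorem toFermionsLinear_apply (A : Op n) : toFermionsLinear e A = toFermions e A := rfl

theorem toFermions_one : toFermions e 1 = 1 := by
  rw [← tensorOp_one, toFermions_tensorOp]
  simp [siteMap_one]

/-- Both sides are bilinear and tensor products span, so it suffices to multiply tensor products;
there the factors can be regrouped by site because different sites commute. -/
theorem toFermions_mul (A B : Op n) : toFermions e (A * B) = toFermions e A * toFermions e B := by
  simp only [← toFermionsLinear_apply]
  have hA : A ∈ Submodule.span ℂ (Set.range (tensorOp (n := n))) := by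
    simp [span_range_tensorOp]
  have hB : B ∈ Submodule.span ℂ (Set.range (tensorOp (n := n))) := by
    simp [span_range_tensorOp]
  induction hA using Submodule.span_induction with
  | zero => simp
  | add A A' _ _ h h' => rw [add_mul, map_add, h, h', map_add, add_mul]
  | smul z A _ h => rw [smul_mul_assoc, map_smul, h, map_smul, smul_mul_assoc]
  | mem A hA =>
    obtain ⟨A, rfl⟩ := hA
    induction hB using Submodule.span_induction with
    | zero => simp
    | add B B' _ _ h h' => rw [mul_add, map_add, h, h', map_add, mul_add]
    | smul z B _ h => rw [mul_smul_comm, map_smul, h, map_smul, mul_smul_comm]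
    | mem B hB =>
      obtain ⟨B, rfl⟩ := hB
      simp only [toFermionsLinear_apply]
      rw [tensorOp_mul, toFermions_tensorOp, toFermions_tensorOp, toFermions_tensorOp,
        prod_ofFn_mul_prod_ofFn _ _ fun i j hij => siteMap_commute e hij _ _]
      simp only [siteMap_mul]

theorem toFermions_star (A : Op n) : toFermions e (star A) = star (toFermions e A) := by
  simp only [← toFermionsLinear_apply]
  have hA : A ∈ Submodule.span ℂ (Set.range (tensorOp (n := n))) := by
    simp [span_range_tensorOp]
  induction hA using Submodule.span_induction with
  | zero => simp
  | add A A' _ _ h h' => simp only [star_add, map_add, h, h']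
  | smul z A _ h => simp only [star_smul, map_smul, h]
  | mem A hA =>
    obtain ⟨A, rfl⟩ := hA
    simp only [toFermionsLinear_apply]
    rw [Matrix.star_eq_conjTranspose, tensorOp_conjTranspose, toFermions_tensorOp,
      toFermions_tensorOp, star_prod_ofFn _ fun i j hij => siteMap_commute e hij _ _]
    simp only [← siteMap_star]
    rfl

/-- `toFermions` as a homomorphism of star algebras. -/
def toFermionsHom : Op n →⋆ₐ[ℂ] Op N :=
  { AlgHom.ofLinearMap (toFermionsLinear e) (toFermions_one e) (toFermions_mul e) with
    map_star' := toFermions_star e }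

end

/-! ### Locality of the fermionic Hamiltonian and the pullback of states. -/

section

/-! ### Locality and sparsity -/

theorem prod_pauliImage_mem_evenSpan {n N : ℕ} (e : Fin n × Fin 3 ≃ Fin (2 * N))
    (S : Finset (Fin n)) (P : Fin n → Fin 4) (hP : ∀ j, j ∉ S → P j = 0) :
    (List.ofFn fun j => pauliImage e j (P j)).prod ∈
      evenSpan ((S ×ˢ (Finset.univ : Finset (Fin 3))).map e.toEmbedding) := by
  -- Arbitrary lists of sites permit induction; the ordered product over all sites is a special
  -- case.
  have key : ∀ l : List (Fin n),
      (l.map fun j => pauliImage e j (P j)).prod ∈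
        evenSpan ((S ×ˢ (Finset.univ : Finset (Fin 3))).map e.toEmbedding) := by
    intro l
    induction l with
    | nil => exact one_mem_evenSpan _
    | cons j l ih =>
      rw [List.map_cons, List.prod_cons]
      by_cases hj : j ∈ S
      · have hmem : ∀ a, e (j, a) ∈ (S ×ˢ (Finset.univ : Finset (Fin 3))).map e.toEmbedding := by
          intro a
          simp [hj]
        generalize P j = p
        fin_cases p
        · simpa [pauliImage] using ih
        all_goals
          simp only [pauliImage]
          simp only [Matrix.cons_val, Fin.mk_one, Fin.reduceFinMk, smul_mul_assoc]
          exact Submodule.smul_mem _ _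
            (majorana_mul_majorana_mul_mem_evenSpan (hmem _) (hmem _) ih)
      · rw [hP j hj]
        simpa [pauliImage] using ih
  rw [List.ofFn_eq_map]
  exact key _

theorem toFermions_pauliString {n N : ℕ} (e : Fin n × Fin 3 ≃ Fin (2 * N)) (P : Fin n → Fin 4) :
    toFermions e (pauliString P) = (List.ofFn fun j => pauliImage e j (P j)).prod := by
  rw [pauliString, toFermions_tensorOp]
  simp only [siteMap_pauli]

-- A star homomorphism between C⋆-algebras is contractive.
open scoped Matrix.Norms.L2Operator in
theorem opNorm_toFermions_le {n N : ℕ} (e : Fin n × Fin 3 ≃ Fin (2 * N)) (A : Op n) :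
    opNorm (toFermions e A) ≤ opNorm A := by
  simp only [opNorm, ← Matrix.cstar_norm_def]
  exact NonUnitalStarAlgHom.norm_apply_le (toFermionsHom e) A

open scoped MatrixOrder in
theorem exists_eq_conjTranspose_mul_self {ι : Type*} [Fintype ι] [DecidableEq ι]
    {A : Matrix ι ι ℂ} (hA : A.PosSemidef) : ∃ B : Matrix ι ι ℂ, A = B.conjTranspose * B :=
  CStarAlgebra.nonneg_iff_eq_star_mul_self.1 hA.nonneg

theorem toFermions_posSemidef {n N : ℕ} (e : Fin n × Fin 3 ≃ Fin (2 * N)) {A : Op n}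
    (hA : A.PosSemidef) : (toFermions e A).PosSemidef := by
  obtain ⟨B, rfl⟩ := exists_eq_conjTranspose_mul_self hA
  rw [toFermions_mul, ← Matrix.star_eq_conjTranspose, toFermions_star]
  exact Matrix.posSemidef_conjTranspose_mul_self _

theorem isLocalSparseFermionic_toFermions {n N : ℕ} (e : Fin n × Fin 3 ≃ Fin (2 * N)) {k d : ℕ}
    {H : Op n} (hH : IsLocalSparseQubit k d H) :
    IsLocalSparseFermionic (3 * k) d (toFermions e H) := by
  obtain ⟨hpos, r, h, S, rfl, hh, hd⟩ := hH
  refine ⟨toFermions_posSemidef e hpos, r, fun i => toFermions e (h i),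
    fun i => (S i ×ˢ (Finset.univ : Finset (Fin 3))).map e.toEmbedding, ?_, fun i => ?_,
    fun l => ?_⟩
  · exact map_sum (toFermionsLinear e) _ _
  · obtain ⟨h1, h2, h3, h4⟩ := hh i
    refine ⟨?_, (opNorm_toFermions_le e _).trans h2, ?_, ?_⟩
    · rw [Matrix.IsHermitian, ← Matrix.star_eq_conjTranspose, ← toFermions_star,
        Matrix.star_eq_conjTranspose, h1.eq]
    · rw [Finset.card_map, Finset.card_product, Finset.card_fin, mul_comm]
      exact Nat.mul_le_mul_left _ h3
    · have : Submodule.map (toFermionsLinear e) (Submodule.span ℂ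
          {A : Op n | ∃ P : Fin n → Fin 4, (∀ j, j ∉ S i → P j = 0) ∧ A = pauliString P}) ≤
          evenSpan ((S i ×ˢ (Finset.univ : Finset (Fin 3))).map e.toEmbedding) := by
        rw [Submodule.map_span_le]
        rintro _ ⟨P, hP, rfl⟩
        rw [toFermionsLinear_apply, toFermions_pauliString]
        exact prod_pauliImage_mem_evenSpan e _ P hP
      exact this (Submodule.mem_map_of_mem h4)
  · obtain ⟨⟨j, a⟩, rfl⟩ := e.surjective l
    simpa using hd j

/-! ### The dual map on states -/

theorem posSemidef_mul_trace_nonneg {ι : Type*} [Fintype ι] [DecidableEq ι] {A B : Matrix ι ι ℂ}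
    (hA : A.PosSemidef) (hB : B.PosSemidef) : 0 ≤ (A * B).trace := by
  obtain ⟨C, rfl⟩ := exists_eq_conjTranspose_mul_self hB
  rw [← mul_assoc, Matrix.trace_mul_comm, ← mul_assoc]
  exact (hA.mul_mul_conjTranspose_same C).trace_nonneg

/-- The qubit state with the same expectation values as the fermionic state `ρ`. -/
def qubitState {n N : ℕ} (e : Fin n × Fin 3 ≃ Fin (2 * N)) (ρ : Op N) : Op n :=
  Matrix.of fun s t => (toFermions e (Matrix.single t s 1) * ρ).trace

/-- The entries of `qubitState` are the expectation values of the images of matrix units, so this is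
linearity in `A`. -/
theorem trace_mul_qubitState {n N : ℕ} (e : Fin n × Fin 3 ≃ Fin (2 * N)) (ρ : Op N) (A : Op n) :
    (A * qubitState e ρ).trace = (toFermions e A * ρ).trace := by
  nth_rw 2 [Matrix.matrix_eq_sum_single A]
  have h : ∀ s t, Matrix.single s t (A s t) = A s t • Matrix.single s t (1 : ℂ) := by simp
  simp only [h, ← toFermionsLinear_apply, map_sum, map_smul, Finset.sum_mul, Matrix.trace_sum,
    smul_mul_assoc, Matrix.trace_smul]
  simp only [Matrix.trace, Matrix.diag_apply, Matrix.mul_apply, qubitState, Matrix.of_apply,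
    toFermionsLinear_apply, smul_eq_mul]

theorem isState_qubitState {n N : ℕ} (e : Fin n × Fin 3 ≃ Fin (2 * N)) {ρ : Op N}
    (hρ : IsState ρ) : IsState (qubitState e ρ) := by
  have hpos : ∀ A : Op n, A.PosSemidef → 0 ≤ (A * qubitState e ρ).trace := fun A hA => by
    rw [trace_mul_qubitState]
    exact posSemidef_mul_trace_nonneg (toFermions_posSemidef e hA) hρ.1
  refine ⟨?_, ?_⟩
  · have hx : ∀ x : (Fin n → Fin 2) → ℂ, 0 ≤ star x ⬝ᵥ (qubitState e ρ).mulVec x := by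
      intro x
      have := hpos _ (Matrix.posSemidef_vecMulVec_self_star x)
      rwa [Matrix.vecMulVec_mul, Matrix.trace_vecMulVec, dotProduct_comm,
        ← Matrix.dotProduct_mulVec] at this
    refine Matrix.posSemidef_iff_dotProduct_mulVec.2 ⟨?_, hx⟩
    ext s t
    rw [Matrix.conjTranspose_apply, qubitState, Matrix.of_apply, Matrix.of_apply,
      ← Matrix.trace_conjTranspose, Matrix.conjTranspose_mul, hρ.1.isHermitian.eq,
      Matrix.trace_mul_comm, ← Matrix.star_eq_conjTranspose, ← toFermions_star,
      Matrix.star_eq_conjTranspose, Matrix.conjTranspose_single, star_one]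
  · rw [← one_mul (qubitState e ρ), trace_mul_qubitState, toFermions_one, one_mul, hρ.2]

end

/-! ### Polynomial approximation of the projection onto the ground state. -/

section

/-! ### Chebyshev approximation -/

/-- The recursion gives T_{l+2} − T_{l+1} = (T_{l+1} − T_l) + 2x T_{l+1} at 1 + x, and T_{l+1} ≥ 1
there. So the increments are at least (2l + 1)x, and they sum to l²x. -/
theorem one_add_sq_mul_le_eval_chebyshevT {x : ℝ} (hx : 0 ≤ x) (l : ℕ) :
    1 + (l : ℝ) ^ 2 * x ≤ (Polynomial.Chebyshev.T ℝ l).eval (1 + x) := by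
  have key : ∀ l : ℕ, 1 + (l : ℝ) ^ 2 * x ≤ (Polynomial.Chebyshev.T ℝ l).eval (1 + x) ∧
      (2 * l + 1 : ℝ) * x ≤ (Polynomial.Chebyshev.T ℝ (l + 1)).eval (1 + x) -
        (Polynomial.Chebyshev.T ℝ l).eval (1 + x) := by
    intro l
    induction l with
    | zero => simp
    | succ l ih =>
      obtain ⟨h1, h2⟩ := ih
      have h3 : 1 + ((l + 1 : ℕ) : ℝ) ^ 2 * x ≤
          (Polynomial.Chebyshev.T ℝ ((l + 1 : ℕ) : ℤ)).eval (1 + x) := by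
        push_cast
        linarith
      refine ⟨h3, ?_⟩
      push_cast at h3 ⊢
      have h4 := Polynomial.Chebyshev.T_add_two ℝ (l : ℤ)
      rw [show (l : ℤ) + 1 + 1 = l + 2 by ring, h4]
      simp only [Polynomial.eval_sub, Polynomial.eval_mul, Polynomial.eval_X,
        Polynomial.eval_ofNat]
      have h5 : 0 ≤ x * ((Polynomial.Chebyshev.T ℝ (l + 1)).eval (1 + x) - 1) :=
        mul_nonneg hx (by nlinarith [sq_nonneg ((l : ℝ) + 1)])
      linarith
  exact (key l).1

/-- The affine map x ↦ 1 − 2(x − 1)/R carries [1, R] into [−1, 1], where Chebyshev polynomials are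
bounded by one, and 0 to 1 + 2/R, where they are large. Dividing by the value at the latter point
normalizes at 0. -/
theorem exists_polynomial_one_at_zero_small (l : ℕ) {R : ℝ} (hR : 0 < R) :
    ∃ f : Polynomial ℝ, f.natDegree ≤ l ∧ f.eval 0 = 1 ∧
      ∀ x : ℝ, 1 ≤ x → x ≤ R → |f.eval x| ≤ (1 + 2 * (l : ℝ) ^ 2 / R)⁻¹ := by
  have hpos : 0 < 1 + 2 * (l : ℝ) ^ 2 / R := by positivity
  have hbig := one_add_sq_mul_le_eval_chebyshevT (x := 2 / R) (by positivity) l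
  rw [show 1 + (l : ℝ) ^ 2 * (2 / R) = 1 + 2 * (l : ℝ) ^ 2 / R by ring] at hbig
  set τ := (Polynomial.Chebyshev.T ℝ l).eval (1 + 2 / R) with hτ
  refine ⟨Polynomial.C τ⁻¹ * (Polynomial.Chebyshev.T ℝ l).comp
    (Polynomial.C (-2 / R) * Polynomial.X + Polynomial.C (1 + 2 / R)), ?_, ?_, fun x h1 h2 => ?_⟩
  · refine (Polynomial.natDegree_C_mul_le _ _).trans (Polynomial.natDegree_comp_le.trans ?_)
    refine (Nat.mul_le_mul_left _ Polynomial.natDegree_linear_le).trans ?_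
    rw [mul_one, Polynomial.Chebyshev.natDegree_T, Int.natAbs_natCast]
  · simp only [Polynomial.eval_mul, Polynomial.eval_C, Polynomial.eval_comp, Polynomial.eval_add,
      Polynomial.eval_X, mul_zero, zero_add, ← hτ]
    exact inv_mul_cancel₀ (by linarith)
  · simp only [Polynomial.eval_mul, Polynomial.eval_C, Polynomial.eval_comp, Polynomial.eval_add,
      Polynomial.eval_X, abs_mul]
    have h3 : |(Polynomial.Chebyshev.T ℝ l).eval (-2 / R * x + (1 + 2 / R))| ≤ 1 := by
      refine Polynomial.Chebyshev.abs_eval_T_real_le_one _ ?_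
      rw [show -2 / R * x + (1 + 2 / R) = 1 - 2 * ((x - 1) / R) by ring, abs_le]
      have h4 : 0 ≤ (x - 1) / R := div_nonneg (by linarith) hR.le
      have h5 : (x - 1) / R ≤ 1 := by
        rw [div_le_one hR]
        linarith
      constructor <;> linarith
    rw [abs_of_pos (inv_pos.2 (hpos.trans_le hbig))]
    calc τ⁻¹ * _ ≤ τ⁻¹ * 1 := by
          refine mul_le_mul_of_nonneg_left h3 (inv_pos.2 (hpos.trans_le hbig)).le
      _ ≤ _ := by
          rw [mul_one]
          exact inv_anti₀ hpos hbig

/-! ### Approximate ground state projections -/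

theorem aeval_mul_of_mul_eq {ι : Type*} [Fintype ι] [DecidableEq ι] {H Y : Matrix ι ι ℂ} {x : ℝ}
    (h : H * Y = x • Y) (f : Polynomial ℝ) : Polynomial.aeval H f * Y = f.eval x • Y := by
  induction f using Polynomial.induction_on' with
  | add p q hp hq => simp [add_mul, add_smul, hp, hq]
  | monomial n a =>
    have : H ^ n * Y = x ^ n • Y := by
      induction n with
      | zero => simp
      | succ n ih => rw [pow_succ, mul_assoc, h, mul_smul_comm, ih, smul_smul, pow_succ']
    rw [Polynomial.aeval_monomial, mul_assoc, this, Polynomial.eval_monomial,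
      Algebra.algebraMap_eq_smul_one, smul_mul_assoc, one_mul, smul_smul]

theorem trace_star_mul_self_re_nonneg {ι : Type*} [Fintype ι] [DecidableEq ι]
    (A : Matrix ι ι ℂ) : 0 ≤ (star A * A).trace.re :=
  (Complex.le_def.1 (Matrix.posSemidef_conjTranspose_mul_self A).trace_nonneg).1

/-- Pythagoras for the Hilbert–Schmidt inner product: different eigenvalues of the Hermitian `H`
give orthogonal `Y k`. -/
theorem trace_star_sum_mul_sum {ι : Type*} [Fintype ι] [DecidableEq ι] {H : Matrix ι ι ℂ}
    (hH : star H = H) {Y : ℕ → Matrix ι ι ℂ} (hY : ∀ k, H * Y k = (k : ℝ) • Y k)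
    (s : Finset ℕ) (a : ℕ → ℝ) :
    (star (∑ k ∈ s, a k • Y k) * ∑ k ∈ s, a k • Y k).trace.re =
      ∑ k ∈ s, a k ^ 2 * (star (Y k) * Y k).trace.re := by
  have horth : ∀ k l, k ≠ l → (star (Y k) * Y l).trace = 0 := by
    intro k l hkl
    have h1 : star (Y k) * (H * Y l) = star (H * Y k) * Y l := by
      rw [star_mul, hH, mul_assoc]
    rw [hY, hY, star_smul, mul_smul_comm, smul_mul_assoc, star_trivial (k : ℝ)] at h1
    have h2 := congrArg Matrix.trace h1
    rw [Matrix.trace_smul, Matrix.trace_smul, ← sub_eq_zero, ← sub_smul,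
      smul_eq_zero, sub_eq_zero, Nat.cast_inj] at h2
    exact h2.resolve_left hkl.symm
  simp only [star_sum, Finset.sum_mul_sum, Matrix.trace_sum, star_smul, star_trivial,
    smul_mul_smul_comm, Matrix.trace_smul, Complex.re_sum]
  refine Finset.sum_congr rfl fun k hk => ?_
  rw [Finset.sum_eq_single_of_mem k hk fun l _ hl => by rw [horth k l hl.symm]; simp,
    Complex.smul_re, smul_eq_mul, sq]

/-- Operators A with Aσ = A play the role of vectors. Applying f(H) to Q₂σ keeps its vacuum
component q₂σ and shrinks the excited part to some Z with ‖Z‖² ≤ η²q₂. Since Q₁f(H)Q₂ = 0, Z must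
satisfy Q₁Z = −q₂Q₁σ, whose squared norm is q₂²q₁. Comparing norms gives q₂²q₁ ≤ η²q₂. -/
theorem mul_le_sq_of_mul_aeval_mul_eq_zero {ι : Type*} [Fintype ι] [DecidableEq ι]
    {H σ Q₁ Q₂ : Matrix ι ι ℂ} (hH : star H = H) (hσ : star σ = σ) (hσσ : σ * σ = σ)
    (hσ1 : σ.trace = 1) (hQ₁ : star Q₁ = Q₁) (hQQ₁ : Q₁ * Q₁ = Q₁) (hQ₂ : star Q₂ = Q₂)
    (hQQ₂ : Q₂ * Q₂ = Q₂) {r : ℕ} {Y : ℕ → Matrix ι ι ℂ} (hY : ∀ k, H * Y k = (k : ℝ) • Y k)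
    (hYσ : ∀ k, Y k * σ = Y k) {z : ℂ} (hY0 : Y 0 = z • σ) (hHσ : H * σ = 0)
    (hsum : Q₂ * σ = ∑ k ∈ Finset.range (r + 1), Y k) {f : Polynomial ℝ} (hf0 : f.eval 0 = 1)
    {η : ℝ} (hf : ∀ k : ℕ, 1 ≤ k → k ≤ r → |f.eval (k : ℝ)| ≤ η)
    (hzero : Q₁ * Polynomial.aeval H f * Q₂ = 0) (hpos : 0 < (Q₂ * σ).trace.re) :
    (Q₁ * σ).trace.re * (Q₂ * σ).trace.re ≤ η ^ 2 := by
  have hσH : σ * H = 0 := by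
    have := congrArg star hHσ
    rwa [star_mul, hσ, hH, star_zero] at this
  -- Excited components are orthogonal to the vacuum, so the trace of Q₂σ sees only the component `Y
  -- 0`.
  have htr : ∀ k, k ≠ 0 → (Y k).trace = 0 := by
    intro k hk
    have h1 : (σ * Y k).trace = (Y k).trace := by rw [Matrix.trace_mul_comm, hYσ]
    have h2 : σ * (H * Y k) = 0 := by rw [← mul_assoc, hσH, zero_mul]
    rw [hY, mul_smul_comm] at h2
    rcases smul_eq_zero.1 h2 with h3 | h3
    · exact absurd (Nat.cast_eq_zero.1 h3) hk
    · rw [← h1, h3, Matrix.trace_zero]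
  have hz : z = (Q₂ * σ).trace := by
    rw [hsum, Matrix.trace_sum, Finset.sum_eq_single_of_mem 0 (by simp) fun k _ hk => htr k hk,
      hY0, Matrix.trace_smul, hσ1, smul_eq_mul, mul_one]
  have hreal : ∀ Q : Matrix ι ι ℂ, star Q = Q → (Q * σ).trace = ((Q * σ).trace.re : ℂ) := by
    intro Q hQ
    have : star (Q * σ).trace = (Q * σ).trace := by
      rw [← Matrix.trace_conjTranspose, ← Matrix.star_eq_conjTranspose, star_mul, hσ, hQ,
        Matrix.trace_mul_comm]
    exact (Complex.conj_eq_iff_re.1 this).symm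
  set q₁ := (Q₁ * σ).trace.re with hq₁
  set q₂ := (Q₂ * σ).trace.re with hq₂
  set Z := ∑ k ∈ (Finset.range (r + 1)).erase 0, f.eval (k : ℝ) • Y k with hZ
  have hfull : Polynomial.aeval H f * (Q₂ * σ) = z • σ + Z := by
    rw [hsum, Finset.mul_sum, Finset.sum_congr rfl fun k _ => aeval_mul_of_mul_eq (hY k) f,
      ← Finset.add_sum_erase _ _ (show 0 ∈ Finset.range (r + 1) by simp), Nat.cast_zero, hf0,
      one_smul, hY0]
  have hQZ : (Q₁ * Z).trace = -(q₁ * q₂ : ℂ) := by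
    have h1 : Q₁ * (z • σ + Z) = 0 := by
      rw [← hfull, ← mul_assoc, ← mul_assoc, hzero, zero_mul]
    have h2 := congrArg Matrix.trace h1
    rw [mul_add, Matrix.trace_add, mul_smul_comm, Matrix.trace_smul, hz, hreal Q₁ hQ₁,
      hreal Q₂ hQ₂, Matrix.trace_zero, smul_eq_mul] at h2
    linear_combination h2
  have hZσ : Z * σ = Z := by
    rw [hZ, Finset.sum_mul]
    exact Finset.sum_congr rfl fun k _ => by rw [smul_mul_assoc, hYσ]
  have hnorm : (star Z * Z).trace.re ≤ η ^ 2 * q₂ := by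
    have h1 : (star (Q₂ * σ) * (Q₂ * σ)).trace.re = q₂ := by
      rw [star_mul, hσ, hQ₂, mul_assoc, ← mul_assoc Q₂, hQQ₂, Matrix.trace_mul_comm, mul_assoc,
        hσσ]
    have h2 := trace_star_sum_mul_sum hH hY (Finset.range (r + 1)) (fun _ => 1)
    simp only [one_smul, ← hsum, h1, one_pow, one_mul] at h2
    rw [h2, trace_star_sum_mul_sum hH hY, Finset.mul_sum]
    refine (Finset.sum_le_sum fun k hk => ?_).trans
      (Finset.sum_le_sum_of_subset_of_nonneg (Finset.erase_subset _ _) fun k _ _ =>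
        mul_nonneg (sq_nonneg η) (trace_star_mul_self_re_nonneg _))
    rw [Finset.mem_erase, Finset.mem_range] at hk
    refine mul_le_mul_of_nonneg_right ?_ (trace_star_mul_self_re_nonneg _)
    rw [← sq_abs]
    exact pow_le_pow_left₀ (abs_nonneg _) (hf k (by omega) (by omega)) 2
  -- This operator equals (1 − Q₁)Z, so its norm measures by how much ‖Z‖ exceeds ‖Q₁Z‖.
  have hpos' := trace_star_mul_self_re_nonneg ((q₂ : ℂ) • (Q₁ * σ) + Z)
  have hexp : (star ((q₂ : ℂ) • (Q₁ * σ) + Z) * ((q₂ : ℂ) • (Q₁ * σ) + Z)).trace =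
      (q₂ : ℂ) ^ 2 * q₁ + 2 * q₂ * -(q₁ * q₂ : ℂ) + (star Z * Z).trace := by
    have e1 : (star (Q₁ * σ) * (Q₁ * σ)).trace = q₁ := by
      rw [star_mul, hσ, hQ₁, mul_assoc, ← mul_assoc Q₁, hQQ₁, Matrix.trace_mul_comm, mul_assoc,
        hσσ, hreal Q₁ hQ₁]
    have e2 : (star (Q₁ * σ) * Z).trace = -(q₁ * q₂ : ℂ) := by
      rw [star_mul, hσ, hQ₁, mul_assoc, Matrix.trace_mul_comm, mul_assoc, hZσ, hQZ]
    have e3 : (star Z * (Q₁ * σ)).trace = -(q₁ * q₂ : ℂ) := by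
      have : star Z * (Q₁ * σ) = star (star (Q₁ * σ) * Z) := by rw [star_mul, star_star]
      rw [this, Matrix.star_eq_conjTranspose, Matrix.trace_conjTranspose, e2]
      simp
    have hstar : star ((q₂ : ℂ) • (Q₁ * σ) + Z) = (q₂ : ℂ) • star (Q₁ * σ) + star Z := by
      rw [star_add, star_smul]
      simp
    rw [hstar]
    simp only [add_mul, mul_add, Matrix.trace_add, smul_mul_assoc, mul_smul_comm,
      Matrix.trace_smul, e1, e2, e3, smul_eq_mul]
    ring
  rw [hexp] at hpos'
  have hre : ((q₂ : ℂ) ^ 2 * q₁ + 2 * q₂ * -(q₁ * q₂ : ℂ) + (star Z * Z).trace).re =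
      q₂ ^ 2 * q₁ + 2 * q₂ * -(q₁ * q₂) + (star Z * Z).trace.re := by
    have : ((q₂ : ℂ) ^ 2 * q₁ + 2 * q₂ * -(q₁ * q₂ : ℂ)) =
      ((q₂ ^ 2 * q₁ + 2 * q₂ * -(q₁ * q₂) : ℝ) : ℂ) := by push_cast; ring
    rw [Complex.add_re, this, Complex.ofReal_re]
  rw [hre] at hpos'
  have : q₂ * (q₁ * q₂) ≤ q₂ * η ^ 2 := by nlinarith
  exact le_of_mul_le_mul_left this hpos

end

/-! ### Number operators and the reduction to few fermionic modes. -/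

section

/-! ### Canonical anticommutation relations -/

/-- The canonical anticommutation relations for annihilation operators `b i`. -/
structure IsCAR {κ A : Type*} [DecidableEq κ] [Ring A] [StarRing A] (b : κ → A) : Prop where
  anti : ∀ i j, b i * b j + b j * b i = 0
  mixed : ∀ i j, b i * star (b j) + star (b j) * b i = if i = j then 1 else 0

section CAR

variable {ι : Type*} [Fintype ι] [DecidableEq ι] {r : ℕ} {b : Fin r → Matrix ι ι ℂ}

theorem IsCAR.star_mul_star (hb : IsCAR b) (i j : Fin r) :
    star (b i) * star (b j) = -(star (b j) * star (b i)) := by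
  have := congrArg star (hb.anti i j)
  rw [star_add, star_mul, star_mul, star_zero, add_comm] at this
  exact eq_neg_of_add_eq_zero_left this

theorem IsCAR.mul_star (hb : IsCAR b) (i j : Fin r) :
    b i * star (b j) = (if i = j then 1 else 0) - star (b j) * b i :=
  eq_sub_of_add_eq (hb.mixed i j)

/-- A product of creation operators. -/
def creationWord (b : Fin r → Matrix ι ι ℂ) (L : List (Fin r)) : Matrix ι ι ℂ :=
  (L.map fun i => star (b i)).prod

theorem creationWord_cons (i : Fin r) (L : List (Fin r)) :
    creationWord b (i :: L) = star (b i) * creationWord b L := by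
  simp [creationWord]

/-- Pauli exclusion: the repeated creation operator can be moved next to its copy, and its square
vanishes. -/
theorem IsCAR.star_mul_creationWord_eq_zero (hb : IsCAR b) {i : Fin r} {L : List (Fin r)}
    (h : i ∈ L) : star (b i) * creationWord b L = 0 := by
  induction L with
  | nil => simp at h
  | cons j L ih =>
    rw [creationWord_cons, ← mul_assoc]
    rcases List.mem_cons.1 h with rfl | h
    · have h2 : (2 : ℂ) • (star (b i) * star (b i)) = 0 := by
        rw [two_smul, ← eq_neg_iff_add_eq_zero]
        exact hb.star_mul_star i i
      rw [(smul_eq_zero.1 h2).resolve_left two_ne_zero, zero_mul]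
    · rw [hb.star_mul_star, neg_mul, mul_assoc, ih h, mul_zero, neg_zero]

theorem IsCAR.creationWord_eq_zero (hb : IsCAR b) {L : List (Fin r)} (h : ¬ L.Nodup) :
    creationWord b L = 0 := by
  induction L with
  | nil => simp at h
  | cons j L ih =>
    rw [creationWord_cons]
    by_cases hj : j ∈ L
    · exact hb.star_mul_creationWord_eq_zero hj
    · rw [ih (fun hL => h (List.nodup_cons.2 ⟨hj, hL⟩)), mul_zero]

/-- The number operator. -/
def numberOp (b : Fin r → Matrix ι ι ℂ) : Matrix ι ι ℂ := ∑ i, star (b i) * b i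

omit [DecidableEq ι] in
theorem star_numberOp : star (numberOp b) = numberOp b := by
  simp [numberOp, star_sum, star_mul]

theorem IsCAR.numberOp_mul_star (hb : IsCAR b) (j : Fin r) :
    numberOp b * star (b j) = star (b j) * numberOp b + star (b j) := by
  have h : ∀ i, star (b i) * b i * star (b j) =
      star (b j) * (star (b i) * b i) + if i = j then star (b j) else 0 := by
    intro i
    rw [mul_assoc, hb.mul_star, mul_sub, ← mul_assoc, hb.star_mul_star i j, neg_mul, sub_neg_eq_add,
      mul_assoc, add_comm]
    congr 1
    split_ifs with hij
    · rw [hij, mul_one]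
    · rw [mul_zero]
  simp [numberOp, Finset.sum_mul, Finset.mul_sum, h, Finset.sum_add_distrib]

variable {σ : Matrix ι ι ℂ}

theorem numberOp_mul_vacuum (hσ : ∀ i, b i * σ = 0) : numberOp b * σ = 0 := by
  simp [numberOp, Finset.sum_mul, mul_assoc, hσ]

theorem IsCAR.numberOp_mul_creationWord (hb : IsCAR b) (hσ : ∀ i, b i * σ = 0)
    (L : List (Fin r)) :
    numberOp b * (creationWord b L * σ) = (L.length : ℝ) • (creationWord b L * σ) := by
  induction L with
  | nil => simp [creationWord, numberOp_mul_vacuum hσ]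
  | cons j L ih =>
    rw [creationWord_cons, mul_assoc, ← mul_assoc, hb.numberOp_mul_star, add_mul, mul_assoc, ih,
      mul_smul_comm, List.length_cons, Nat.cast_add, add_smul, Nat.cast_one, one_smul]

/-- The span of the states obtained from the vacuum by creation operators. -/
def creationSpan (b : Fin r → Matrix ι ι ℂ) (σ : Matrix ι ι ℂ) : Submodule ℂ (Matrix ι ι ℂ) :=
  Submodule.span ℂ (Set.range fun L => creationWord b L * σ)

theorem creationWord_mem (L : List (Fin r)) : creationWord b L * σ ∈ creationSpan b σ :=
  Submodule.subset_span ⟨L, rfl⟩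

theorem star_mul_mem_creationSpan (i : Fin r) {A : Matrix ι ι ℂ} (hA : A ∈ creationSpan b σ) :
    star (b i) * A ∈ creationSpan b σ := by
  induction hA using Submodule.span_induction with
  | zero => simp
  | add A B _ _ hA hB => rw [mul_add]; exact add_mem hA hB
  | smul z A _ hA => rw [mul_smul_comm]; exact Submodule.smul_mem _ _ hA
  | mem A hA =>
    obtain ⟨L, rfl⟩ := hA
    simp only [← mul_assoc, ← creationWord_cons]
    exact creationWord_mem _

theorem IsCAR.mul_mem_creationSpan (hb : IsCAR b) (hσ : ∀ i, b i * σ = 0) (i : Fin r)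
    {A : Matrix ι ι ℂ} (hA : A ∈ creationSpan b σ) : b i * A ∈ creationSpan b σ := by
  induction hA using Submodule.span_induction with
  | zero => simp
  | add A B _ _ hA hB => rw [mul_add]; exact add_mem hA hB
  | smul z A _ hA => rw [mul_smul_comm]; exact Submodule.smul_mem _ _ hA
  | mem A hA =>
    obtain ⟨L, rfl⟩ := hA
    simp only
    induction L with
    | nil => simp [creationWord, hσ]
    | cons j L ih =>
      rw [creationWord_cons, mul_assoc, ← mul_assoc, hb.mul_star, sub_mul, mul_assoc]
      refine sub_mem ?_ (star_mul_mem_creationSpan _ ih)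
      split_ifs
      · rw [one_mul]; exact creationWord_mem _
      · simp

/-- The Fock space over the vacuum is invariant under all `b i` and their adjoints, hence under the
algebra they generate. -/
theorem IsCAR.adjoin_mul_mem_creationSpan (hb : IsCAR b) (hσ : ∀ i, b i * σ = 0)
    {Q : Matrix ι ι ℂ} (hQ : Q ∈ Algebra.adjoin ℂ (Set.range b ∪ Set.range fun i => star (b i)))
    {A : Matrix ι ι ℂ} (hA : A ∈ creationSpan b σ) : Q * A ∈ creationSpan b σ := by
  induction hQ using Algebra.adjoin_induction generalizing A with
  | mem Q hQ =>
    rcases hQ with ⟨i, rfl⟩ | ⟨i, rfl⟩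
    · exact hb.mul_mem_creationSpan hσ i hA
    · exact star_mul_mem_creationSpan i hA
  | algebraMap z =>
    rw [Algebra.algebraMap_eq_smul_one, smul_mul_assoc, one_mul]
    exact Submodule.smul_mem _ _ hA
  | add Q R _ _ hQ hR => rw [add_mul]; exact add_mem (hQ hA) (hR hA)
  | mul Q R _ _ hQ hR => rw [mul_assoc]; exact hQ (hR hA)

/-- Sorting by word length gives eigenoperators of the number operator. Words with a repetition
vanish, so lengths stop at `r`, the number of modes. -/
theorem IsCAR.exists_graded (hb : IsCAR b) (hσ : ∀ i, b i * σ = 0) (hσσ : σ * σ = σ)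
    {A : Matrix ι ι ℂ} (hA : A ∈ creationSpan b σ) :
    ∃ Y : ℕ → Matrix ι ι ℂ, (∀ k, numberOp b * Y k = (k : ℝ) • Y k) ∧ (∀ k, Y k * σ = Y k) ∧
      (∃ z : ℂ, Y 0 = z • σ) ∧ A = ∑ k ∈ Finset.range (r + 1), Y k := by
  induction hA using Submodule.span_induction with
  | zero => exact ⟨0, by simp, by simp, ⟨0, by simp⟩, by simp⟩
  | add A B _ _ hA hB =>
    obtain ⟨Y, h1, h2, ⟨z, h3⟩, h4⟩ := hA
    obtain ⟨Y', h1', h2', ⟨z', h3'⟩, h4'⟩ := hB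
    refine ⟨fun k => Y k + Y' k, fun k => ?_, fun k => ?_, ⟨z + z', ?_⟩, ?_⟩
    · rw [mul_add, h1, h1', smul_add]
    · rw [add_mul, h2, h2']
    · simp only [h3, h3', add_smul]
    · rw [h4, h4', Finset.sum_add_distrib]
  | smul w A _ hA =>
    obtain ⟨Y, h1, h2, ⟨z, h3⟩, h4⟩ := hA
    refine ⟨fun k => w • Y k, fun k => ?_, fun k => ?_, ⟨w * z, ?_⟩, ?_⟩
    · rw [mul_smul_comm, h1, smul_comm]
    · rw [smul_mul_assoc, h2]
    · simp only [h3, smul_smul]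
    · rw [h4, Finset.smul_sum]
  | mem A hA =>
    obtain ⟨L, rfl⟩ := hA
    by_cases hL : L.Nodup
    · have hlen : L.length ≤ r := by simpa using hL.length_le_card
      refine ⟨fun k => if k = L.length then creationWord b L * σ else 0, fun k => ?_, fun k => ?_,
        ?_, ?_⟩
      · simp only
        split_ifs with hk
        · rw [hk, hb.numberOp_mul_creationWord hσ]
        · simp
      · simp only
        split_ifs with hk
        · rw [mul_assoc, hσσ]
        · simp
      -- Only the empty word has length zero, so the component at 0 is a multiple of the vacuum.
      · cases L with
        | nil => exact ⟨1, by simp [creationWord]⟩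
        | cons j L => exact ⟨0, by simp⟩
      · rw [Finset.sum_ite_eq', if_pos (Finset.mem_range.2 (by omega))]
    · refine ⟨0, by simp, by simp, ⟨0, by simp⟩, ?_⟩
      simp [hb.creationWord_eq_zero hL]

theorem IsCAR.mul_le_sq (hb : IsCAR b) (hbσ : ∀ i, b i * σ = 0) (hσ : star σ = σ)
    (hσσ : σ * σ = σ) (hσ1 : σ.trace = 1) {Q₁ Q₂ : Matrix ι ι ℂ} (hQ₁ : star Q₁ = Q₁)
    (hQQ₁ : Q₁ * Q₁ = Q₁) (hQ₂ : star Q₂ = Q₂) (hQQ₂ : Q₂ * Q₂ = Q₂)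
    (hmem : Q₂ ∈ Algebra.adjoin ℂ (Set.range b ∪ Set.range fun i => star (b i)))
    {f : Polynomial ℝ} (hf0 : f.eval 0 = 1) {η : ℝ}
    (hf : ∀ k : ℕ, 1 ≤ k → k ≤ r → |f.eval (k : ℝ)| ≤ η)
    (hzero : Q₁ * Polynomial.aeval (numberOp b) f * Q₂ = 0) (hpos : 0 < (Q₂ * σ).trace.re) :
    (Q₁ * σ).trace.re * (Q₂ * σ).trace.re ≤ η ^ 2 := by
  have hvac : σ ∈ creationSpan b σ := by
    have h := creationWord_mem (b := b) (σ := σ) []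
    rwa [creationWord, List.map_nil, List.prod_nil, one_mul] at h
  have hmem' := hb.adjoin_mul_mem_creationSpan hbσ hmem hvac
  obtain ⟨Y, h1, h2, ⟨z, h3⟩, h4⟩ := hb.exists_graded hbσ hσσ hmem'
  exact mul_le_sq_of_mul_aeval_mul_eq_zero star_numberOp hσ hσσ hσ1 hQ₁ hQQ₁ hQ₂ hQQ₂ h1 h2 h3
    (numberOp_mul_vacuum hbσ) h4 hf0 hf hzero hpos

end CAR

/-! ### Bogoliubov reduction to few modes -/

section Reduction

variable {ι : Type*} [Fintype ι] [DecidableEq ι] {M : ℕ}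

/-- The annihilation operator with amplitude `x`. -/
def annihilator (a : Fin M → Matrix ι ι ℂ) : EuclideanSpace ℂ (Fin M) →ₗ[ℂ] Matrix ι ι ℂ where
  toFun x := ∑ j, x j • a j
  map_add' x y := by simp [add_smul, Finset.sum_add_distrib]
  map_smul' z x := by simp [mul_smul, Finset.smul_sum]

omit [Fintype ι] [DecidableEq ι] in
theorem annihilator_apply (a : Fin M → Matrix ι ι ℂ) (x : EuclideanSpace ℂ (Fin M)) :
    annihilator a x = ∑ j, x j • a j := rfl

theorem IsCAR.annihilator {a : Fin M → Matrix ι ι ℂ} (ha : IsCAR a) {r : ℕ}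
    {w : Fin r → EuclideanSpace ℂ (Fin M)} (hw : Orthonormal ℂ w) :
    IsCAR fun i => annihilator a (w i) where
  anti i j := by
    simp only [annihilator_apply, Finset.sum_mul_sum, smul_mul_smul_comm]
    nth_rw 2 [Finset.sum_comm]
    simp only [← Finset.sum_add_distrib]
    refine Finset.sum_eq_zero fun k _ => Finset.sum_eq_zero fun l _ => ?_
    rw [mul_comm (w j l), ← smul_add, ha.anti, smul_zero]
  mixed i j := by
    simp only [annihilator_apply, star_sum, star_smul, Finset.sum_mul_sum, smul_mul_smul_comm]
    nth_rw 2 [Finset.sum_comm]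
    simp only [← Finset.sum_add_distrib]
    have h : ∀ k l, (w i k * star (w j l)) • (a k * star (a l)) +
        (star (w j l) * w i k) • (star (a l) * a k) =
        if k = l then (w i k * star (w j k)) • (1 : Matrix ι ι ℂ) else 0 := by
      intro k l
      rw [mul_comm (star (w j l)), ← smul_add, ha.mixed]
      split_ifs with hkl
      · rw [hkl]
      · simp
    simp only [h, Finset.sum_ite_eq, Finset.mem_univ, if_true, ← Finset.sum_smul]
    have h2 := orthonormal_iff_ite.1 hw j i
    rw [PiLp.inner_apply] at h2
    simp only [RCLike.inner_apply] at h2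
    have h3 : ∑ k, w i k * star (w j k) = if j = i then 1 else 0 := h2
    rw [h3]
    by_cases hij : i = j
    · simp [hij]
    · simp [hij, Ne.symm hij]

/-- Each Hermitian `c k` is an annihilation operator with some amplitude vector plus its adjoint.
The vectors with `k ∈ A` span a space of dimension at most `A.card`, and an orthonormal basis of it
supplies the modes. No creation operators are mixed in, so the new modes annihilate whatever the old
ones do. -/
theorem IsCAR.exists_reduction {a : Fin M → Matrix ι ι ℂ} (ha : IsCAR a) {κ : Type*}
    (A : Finset κ) (c : κ → Matrix ι ι ℂ) (hc : ∀ k, star (c k) = c k)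
    (hspan : ∀ k, c k ∈ Submodule.span ℂ (Set.range a ∪ Set.range fun i => star (a i))) :
    ∃ r ≤ A.card, ∃ b : Fin r → Matrix ι ι ℂ, IsCAR b ∧
      (∀ i, b i ∈ Submodule.span ℂ (Set.range a)) ∧
      ∀ k ∈ A, c k ∈ Algebra.adjoin ℂ (Set.range b ∪ Set.range fun i => star (b i)) := by
  have hx : ∀ k, ∃ x, c k = FNLTS.annihilator a x + star (FNLTS.annihilator a x) := by
    have h : ∀ C ∈ Submodule.span ℂ (Set.range a ∪ Set.range fun i => star (a i)),
        ∃ x y, C = FNLTS.annihilator a x + star (FNLTS.annihilator a y) := by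
      intro C hC
      induction hC using Submodule.span_induction with
      | zero => exact ⟨0, 0, by simp⟩
      | add C D _ _ hC hD =>
        obtain ⟨x, y, rfl⟩ := hC
        obtain ⟨x', y', rfl⟩ := hD
        exact ⟨x + x', y + y', by simp only [map_add, star_add]; abel⟩
      | smul z C _ hC =>
        obtain ⟨x, y, rfl⟩ := hC
        exact ⟨z • x, star z • y, by simp [smul_add, star_smul]⟩
      | mem C hC =>
        rcases hC with ⟨i, rfl⟩ | ⟨i, rfl⟩
        · exact ⟨EuclideanSpace.single i 1, 0, by simp [annihilator_apply]⟩
        · exact ⟨0, EuclideanSpace.single i 1, by simp [annihilator_apply]⟩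
    intro k
    obtain ⟨x, y, hxy⟩ := h _ (hspan k)
    -- Averaging the expansion with its adjoint makes the two amplitude vectors equal.
    refine ⟨(2 : ℂ)⁻¹ • (x + y), ?_⟩
    have h1 : c k = (2 : ℂ)⁻¹ • (c k + star (c k)) := by
      rw [hc, ← two_smul ℂ, smul_smul]
      norm_num
    have h2 : star (2 : ℂ)⁻¹ = (2 : ℂ)⁻¹ := by simp
    rw [h1, hxy]
    simp only [map_smul, map_add, star_smul, star_add, star_star, h2, smul_add]
    abel
  choose x hx using hx
  classical
  let W : Submodule ℂ (EuclideanSpace ℂ (Fin M)) := Submodule.span ℂ (A.image x : Set _)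
  let v := stdOrthonormalBasis ℂ W
  refine ⟨Module.finrank ℂ W, (finrank_span_finset_le_card _).trans Finset.card_image_le,
    fun i => FNLTS.annihilator a (v i), ?_, fun i => ?_, fun k hk => ?_⟩
  · exact ha.annihilator (v.orthonormal.comp_linearIsometry W.subtypeₗᵢ)
  · simp only [annihilator_apply]
    exact sum_mem fun j _ => Submodule.smul_mem _ _ (Submodule.subset_span ⟨j, rfl⟩)
  · have hxk : x k ∈ W := Submodule.subset_span (by simpa using ⟨k, hk, rfl⟩)
    have hrep : FNLTS.annihilator a (x k) =
        ∑ i, v.repr ⟨x k, hxk⟩ i • FNLTS.annihilator a (v i) := by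
      have h1 := congrArg Subtype.val (v.sum_repr ⟨x k, hxk⟩)
      simp only [Submodule.coe_sum, Submodule.coe_smul] at h1
      nth_rw 1 [← h1]
      simp only [map_sum, map_smul]
    rw [hx k, hrep, star_sum]
    refine add_mem (sum_mem fun i _ => ?_) (sum_mem fun i _ => ?_)
    · refine Subalgebra.smul_mem _ (Algebra.mem_adjoin_of_mem ?_) _
      exact Or.inl ⟨i, rfl⟩
    · rw [star_smul]
      refine Subalgebra.smul_mem _ (Algebra.mem_adjoin_of_mem ?_) _
      exact Or.inr ⟨i, rfl⟩

end Reduction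

end

/-! ### Circuits in the Heisenberg picture: growth of degree and of support. -/

section

variable {M : ℕ}

/-! ### Exponentials -/

/-- All powers of `X` lie in this span, which is closed because it is finite-dimensional. Explicit
trigonometric coefficients are never needed. -/
theorem exp_mem_span_pair {X : Op M} {z : ℂ} (h : X * X = z • 1) :
    NormedSpace.exp X ∈ Submodule.span ℂ ({1, X} : Set (Op M)) := by
  have hpow : ∀ k : ℕ, X ^ k ∈ Submodule.span ℂ ({1, X} : Set (Op M)) := by
    intro k
    induction k with
    | zero => exact Submodule.subset_span (by simp)
    | succ k ih =>
      obtain ⟨a, b, hab⟩ := Submodule.mem_span_pair.1 ih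
      rw [pow_succ, ← hab, add_mul, smul_mul_assoc, smul_mul_assoc, h, one_mul, smul_smul]
      exact Submodule.mem_span_pair.2 ⟨b * z, a, by abel⟩
  rw [NormedSpace.exp_eq_tsum ℂ]
  exact tsum_mem (Submodule.closed_of_finiteDimensional _)
    fun k => Submodule.smul_mem _ _ (hpow k)

theorem exp_mem_unitary {X : Op M} (h : star X = -X) : NormedSpace.exp X ∈ unitary (Op M) := by
  have h1 : star (NormedSpace.exp X) = (NormedSpace.exp X)⁻¹ := by
    rw [Matrix.star_eq_conjTranspose, ← Matrix.exp_conjTranspose, ← Matrix.star_eq_conjTranspose, h,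
      Matrix.exp_neg]
  have h2 := (Matrix.isUnit_iff_isUnit_det _).1 (Matrix.isUnit_exp X)
  rw [Unitary.mem_iff, h1]
  exact ⟨Matrix.nonsing_inv_mul _ h2, Matrix.mul_nonsing_inv _ h2⟩

theorem exp_conj_of_commute {X : Op M} {z : ℂ} (hX : X * X = z • 1) (hs : star X = -X) {A : Op M}
    (h : Commute X A) : NormedSpace.exp X * A * star (NormedSpace.exp X) = A := by
  obtain ⟨a, b, hab⟩ := Submodule.mem_span_pair.1 (exp_mem_span_pair hX)
  have hc : Commute (NormedSpace.exp X) A := by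
    rw [← hab]
    exact ((Commute.one_left A).smul_left a).add_left (h.smul_left b)
  rw [hc.eq, mul_assoc, (Unitary.mem_iff.1 (exp_mem_unitary hs)).2, mul_one]

/-- Moving `A` to the right past the adjoint exponential inverts it, so the conjugate is the square
of the exponential times `A`, again affine in `X`. -/
theorem exp_conj_of_anticomm {X : Op M} {z : ℂ} (hX : X * X = z • 1) (hs : star X = -X) {A : Op M}
    (h : X * A = -(A * X)) :
    ∃ p q : ℂ, NormedSpace.exp X * A * star (NormedSpace.exp X) = (p • 1 + q • X) * A := by
  obtain ⟨a, b, hab⟩ := Submodule.mem_span_pair.1 (exp_mem_span_pair hX)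
  have h' : A * X = -(X * A) := by rw [h, neg_neg]
  refine ⟨a * star a + b * star b * z, a * star b + b * star a, ?_⟩
  rw [← hab]
  simp only [star_add, star_smul, star_one, hs, add_mul, mul_add, smul_mul_assoc, mul_smul_comm,
    one_mul, mul_one, mul_neg, smul_neg]
  rw [h', mul_assoc X A X, h']
  simp only [mul_neg, ← mul_assoc, hX, smul_mul_assoc, one_mul]
  module

/-- Conjugation by a unitary operator. -/
def conjHom {U : Op M} (hU : U ∈ unitary (Op M)) : Op M →⋆ₐ[ℂ] Op M :=
  (Unitary.conjStarAlgAut ℂ (Op M) ⟨U, hU⟩ : Op M →⋆ₐ[ℂ] Op M)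

theorem conjHom_apply {U : Op M} (hU : U ∈ unitary (Op M)) (A : Op M) :
    conjHom hU A = U * A * star U := rfl

/-! ### The degree filtration -/

/-- The span of the Majorana operators. -/
def linearSpan (M : ℕ) : Submodule ℂ (Op M) := Submodule.span ℂ (Set.range majorana)

/-- The Majorana polynomials of degree at most one. -/
def degLEOne (M : ℕ) : Submodule ℂ (Op M) := 1 ⊔ linearSpan M

theorem majorana_mem_linearSpan (k : Fin (2 * M)) : majorana k ∈ linearSpan M :=
  Submodule.subset_span ⟨k, rfl⟩

theorem majorana_mem_degLEOne (k : Fin (2 * M)) : majorana k ∈ degLEOne M :=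
  (le_sup_right : linearSpan M ≤ degLEOne M) (majorana_mem_linearSpan k)

theorem degLEOne_pow_mono {d d' : ℕ} (h : d ≤ d') : degLEOne M ^ d ≤ degLEOne M ^ d' :=
  pow_le_pow_right' le_sup_left h

theorem one_mem_degLEOne_pow (d : ℕ) : (1 : Op M) ∈ degLEOne M ^ d :=
  degLEOne_pow_mono (Nat.zero_le d) (by rw [pow_zero]; exact Submodule.one_le.1 le_rfl)

theorem word_mem_degLEOne_pow (l : List (Fin (2 * M))) : word l ∈ degLEOne M ^ l.length := by
  induction l with
  | nil => simp
  | cons k l ih =>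
    rw [word_cons, List.length_cons, pow_succ']
    exact Submodule.mul_mem_mul (majorana_mem_degLEOne k) ih

theorem majoranaString_mem_degLEOne_pow (K : Finset (Fin (2 * M))) :
    majoranaString K ∈ degLEOne M ^ K.card := by
  rw [majoranaString_eq]
  refine Submodule.smul_mem _ _ ?_
  simpa using word_mem_degLEOne_pow (K.sort (· ≤ ·))

theorem star_mem_linearSpan {A : Op M} (h : A ∈ linearSpan M) : star A ∈ linearSpan M := by
  induction h using Submodule.span_induction with
  | zero => simp
  | add A B _ _ hA hB => rw [star_add]; exact add_mem hA hB
  | smul z A _ hA => rw [star_smul]; exact Submodule.smul_mem _ _ hA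
  | mem A hA =>
    obtain ⟨k, rfl⟩ := hA
    rw [star_majorana]
    exact majorana_mem_linearSpan k

/-- Conjugation is an algebra homomorphism, so it suffices to bound the degree on the generators. -/
theorem conj_mem_degLEOne_pow {U : Op M} (hU : U ∈ unitary (Op M)) {D : ℕ}
    (h : ∀ k, U * majorana k * star U ∈ degLEOne M ^ D) {d : ℕ} {A : Op M}
    (hA : A ∈ degLEOne M ^ d) : U * A * star U ∈ degLEOne M ^ (D * d) := by
  have hle : Submodule.map (conjHom hU : Op M →ₐ[ℂ] Op M).toLinearMap (degLEOne M) ≤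
      degLEOne M ^ D := by
    rw [degLEOne, Submodule.map_sup, sup_le_iff]
    constructor
    · rw [Submodule.map_one]
      exact Submodule.one_le.2 (one_mem_degLEOne_pow D)
    · rw [linearSpan, Submodule.map_span_le]
      rintro _ ⟨k, rfl⟩
      exact h k
  have h2 := Submodule.mem_map_of_mem (f := (conjHom hU : Op M →ₐ[ℂ] Op M).toLinearMap) hA
  rw [Submodule.map_pow] at h2
  rw [pow_mul]
  exact pow_le_pow_left' hle d h2

theorem aeval_mem_degLEOne_pow {H : Op M} {d : ℕ} (hH : H ∈ degLEOne M ^ d) (f : Polynomial ℝ)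
    {l : ℕ} (hf : f.natDegree ≤ l) : Polynomial.aeval H f ∈ degLEOne M ^ (d * l) := by
  rw [Polynomial.aeval_eq_sum_range]
  refine sum_mem fun i hi => ?_
  rw [← Complex.coe_smul]
  refine Submodule.smul_mem _ _ (degLEOne_pow_mono (Nat.mul_le_mul_left d
    ((Nat.lt_succ_iff.1 (Finset.mem_range.1 hi)).trans hf)) ?_)
  rw [pow_mul]
  exact Submodule.pow_mem_pow _ hH i

/-! ### Layers and circuits -/

theorem gate_sq (K : Finset (Fin (2 * M))) (ω : ℝ) :
    ((Complex.I * (ω : ℂ)) • majoranaString K) * ((Complex.I * (ω : ℂ)) • majoranaString K) =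
      (-(ω : ℂ) ^ 2) • (1 : Op M) := by
  rw [smul_mul_smul_comm, majoranaString_mul_self]
  congr 1
  linear_combination (ω : ℂ) ^ 2 * Complex.I_mul_I

theorem star_gate (K : Finset (Fin (2 * M))) (ω : ℝ) :
    star ((Complex.I * (ω : ℂ)) • majoranaString K) =
      -((Complex.I * (ω : ℂ)) • majoranaString K) := by
  rw [star_smul, star_majoranaString, ← neg_smul]
  simp

theorem IsLayer.star {W : Op M} (h : IsLayer W) : IsLayer (star W) := by
  obtain ⟨gates, h1, h2, rfl⟩ := h
  refine ⟨(gates.map fun g => (g.1, -g.2)).reverse, ?_, ?_, ?_⟩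
  · intro g hg
    obtain ⟨g', hg', rfl⟩ := List.mem_map.1 (List.mem_reverse.1 hg)
    exact h1 g' hg'
  · rw [List.pairwise_reverse, List.pairwise_map]
    exact h2.imp fun h => h.symm
  · clear h1 h2
    induction gates with
    | nil => simp
    | cons g gates ih =>
      rw [List.map_cons, List.prod_cons, star_mul, ih, List.map_cons, List.reverse_cons,
        List.map_append, List.prod_append, Matrix.star_eq_conjTranspose,
        ← Matrix.exp_conjTranspose, ← Matrix.star_eq_conjTranspose, star_gate]
      simp

/-- At most one gate contains `k`, and only this gate acts on the Majorana operator. The gates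
applied after it are even and disjoint from its support, so they commute with the result. -/
theorem layer_conj_majorana {gates : List (Finset (Fin (2 * M)) × ℝ)}
    (h1 : ∀ g ∈ gates, g.1.card = 2 ∨ g.1.card = 4)
    (h2 : gates.Pairwise fun g h => Disjoint g.1 h.1) (W : Op M)
    (hW : W = (gates.map fun g =>
      NormedSpace.exp ((Complex.I * (g.2 : ℂ)) • majoranaString g.1)).prod) :
    W ∈ unitary (Op M) ∧ ∀ k, (W * majorana k * star W = majorana k ∨ ∃ g ∈ gates, k ∈ g.1 ∧
      ∃ p q : ℂ, W * majorana k * star W = (p • 1 + q • majoranaString g.1) * majorana k) := by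
  induction gates generalizing W with
  | nil =>
    subst hW
    exact ⟨by simp, fun k => Or.inl (by simp)⟩
  | cons g gates ih =>
    rw [List.pairwise_cons] at h2
    obtain ⟨hu, hc⟩ := ih (fun g' hg' => h1 g' (List.mem_cons_of_mem _ hg')) h2.2 _ rfl
    rw [List.map_cons, List.prod_cons] at hW
    set V := (gates.map fun g =>
      NormedSpace.exp ((Complex.I * (g.2 : ℂ)) • majoranaString g.1)).prod
    set E := NormedSpace.exp ((Complex.I * (g.2 : ℂ)) • majoranaString g.1)
    have hE : E ∈ unitary (Op M) := exp_mem_unitary (star_gate _ _)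
    have heven : Even g.1.card := by
      rcases h1 g (by simp) with h | h <;> rw [h] <;> decide
    have hcomm : ∀ k ∉ g.1, Commute (majoranaString g.1) (majorana k) := fun k hk =>
      (majorana_comm_majoranaString heven hk).symm
    subst hW
    refine ⟨mul_mem hE hu, fun k => ?_⟩
    have hassoc : E * V * majorana k * star (E * V) = E * (V * majorana k * star V) * star E := by
      rw [star_mul]
      simp only [mul_assoc]
    rw [hassoc]
    rcases hc k with hk | ⟨g', hg', hkg', p, q, hpq⟩
    · rw [hk]
      by_cases hkg : k ∈ g.1
      · right
        obtain ⟨p, q, hpq⟩ := exp_conj_of_anticomm (gate_sq g.1 g.2) (star_gate g.1 g.2)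
          (A := majorana k) (by
            rw [smul_mul_assoc, mul_smul_comm, majorana_anticomm_majoranaString heven hkg,
              smul_neg, neg_neg])
        exact ⟨g, by simp, hkg, p, q * (Complex.I * g.2), by rw [hpq, smul_smul]⟩
      · left
        exact exp_conj_of_commute (gate_sq g.1 g.2) (star_gate g.1 g.2)
          ((hcomm k hkg).smul_left _)
    · right
      refine ⟨g', List.mem_cons_of_mem _ hg', hkg', p, q, ?_⟩
      rw [hpq]
      refine exp_conj_of_commute (gate_sq g.1 g.2) (star_gate g.1 g.2) (Commute.smul_left ?_ _)
      have hdisj : ∀ a ∈ g'.1, a ∉ g.1 := fun a ha ha' =>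
        Finset.disjoint_left.1 (h2.1 g' hg') ha' ha
      refine Commute.mul_right ?_ (hcomm k (hdisj k hkg'))
      refine ((Commute.one_right _).smul_right _).add_right (Commute.smul_right ?_ _)
      rw [majoranaString_eq g'.1]
      refine Commute.smul_right (Commute.list_prod_right _ _ fun A hA => ?_) _
      obtain ⟨a, ha, rfl⟩ := List.mem_map.1 hA
      exact hcomm a (hdisj a (by simpa using ha))

theorem IsLayer.conj_majorana {W : Op M} (h : IsLayer W) : W ∈ unitary (Op M) ∧
    ∀ k, ∃ K : Finset (Fin (2 * M)), K.card ≤ 4 ∧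
      ∃ p q : ℂ, W * majorana k * Star.star W = (p • 1 + q • majoranaString K) * majorana k := by
  obtain ⟨gates, h1, h2, h3⟩ := h
  obtain ⟨hu, hc⟩ := layer_conj_majorana h1 h2 W h3
  refine ⟨hu, fun k => ?_⟩
  rcases hc k with hk | ⟨g, hg, -, p, q, hpq⟩
  · exact ⟨∅, by simp, 1, 0, by simp [hk]⟩
  · exact ⟨g.1, by rcases h1 g hg with h | h <;> omega, p, q, hpq⟩

/-- The degree is bounded crudely by 5 = 4 + 1, for a string of at most four factors times one more.
-/
theorem IsLayer.conj_mem_degLEOne_pow {W : Op M} (h : IsLayer W) (k : Fin (2 * M)) :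
    W * majorana k * Star.star W ∈ degLEOne M ^ 5 := by
  obtain ⟨K, hK, p, q, hpq⟩ := h.conj_majorana.2 k
  rw [hpq, pow_succ]
  refine Submodule.mul_mem_mul (add_mem (Submodule.smul_mem _ _ (one_mem_degLEOne_pow _))
    (Submodule.smul_mem _ _ (degLEOne_pow_mono hK (majoranaString_mem_degLEOne_pow K))))
    (majorana_mem_degLEOne k)

/-- The algebra generated by the Majorana operators with indices in `S`. -/
def majoranaAlgebra (S : Finset (Fin (2 * M))) : Subalgebra ℂ (Op M) :=
  Algebra.adjoin ℂ (majorana '' S)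

theorem majorana_mem_majoranaAlgebra {S : Finset (Fin (2 * M))} {k : Fin (2 * M)} (h : k ∈ S) :
    majorana k ∈ majoranaAlgebra S := Algebra.subset_adjoin ⟨k, h, rfl⟩

theorem majoranaAlgebra_mono {S S' : Finset (Fin (2 * M))} (h : S ⊆ S') :
    majoranaAlgebra S ≤ majoranaAlgebra S' :=
  Algebra.adjoin_mono (Set.image_mono (by exact_mod_cast h))

theorem linearSpan_le_majoranaAlgebra :
    linearSpan M ≤ Subalgebra.toSubmodule (majoranaAlgebra (M := M) Finset.univ) := by
  rw [linearSpan, Submodule.span_le]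
  rintro _ ⟨k, rfl⟩
  exact majorana_mem_majoranaAlgebra (Finset.mem_univ k)

theorem majoranaString_mem_majoranaAlgebra (K : Finset (Fin (2 * M))) :
    majoranaString K ∈ majoranaAlgebra K := by
  rw [majoranaString_eq]
  refine Subalgebra.smul_mem _ (list_prod_mem fun A hA => ?_) _
  obtain ⟨a, ha, rfl⟩ := List.mem_map.1 hA
  exact majorana_mem_majoranaAlgebra (by simpa using ha)

theorem conj_mem_of_mem_majoranaAlgebra {U : Op M} (hU : U ∈ unitary (Op M))
    {S : Finset (Fin (2 * M))} {B : Subalgebra ℂ (Op M)}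
    (h : ∀ k ∈ S, U * majorana k * star U ∈ B) {A : Op M} (hA : A ∈ majoranaAlgebra S) :
    U * A * star U ∈ B := by
  have hle : majoranaAlgebra S ≤ B.comap (conjHom hU : Op M →ₐ[ℂ] Op M) := by
    rw [majoranaAlgebra, Algebra.adjoin_le_iff]
    rintro _ ⟨k, hk, rfl⟩
    exact h k hk
  exact hle hA

theorem IsLayer.exists_lightcone {W : Op M} (h : IsLayer W) (S : Finset (Fin (2 * M))) :
    ∃ S' : Finset (Fin (2 * M)), S'.card ≤ 5 * S.card ∧
      ∀ A ∈ majoranaAlgebra S, Star.star W * A * W ∈ majoranaAlgebra S' := by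
  obtain ⟨hu, hK⟩ := h.star.conj_majorana
  choose K hK hpq using hK
  refine ⟨S.biUnion fun k => insert k (K k), ?_, fun A hA => ?_⟩
  · rw [mul_comm 5]
    exact Finset.card_biUnion_le_card_mul _ _ _ fun k _ =>
      (Finset.card_insert_le _ _).trans (Nat.succ_le_succ (hK k))
  · have := conj_mem_of_mem_majoranaAlgebra hu (S := S)
      (B := majoranaAlgebra (S.biUnion fun k => insert k (K k))) (fun k hk => ?_) hA
    · rwa [star_star] at this
    · obtain ⟨p, q, hpq⟩ := hpq k
      have hsub : insert k (K k) ⊆ S.biUnion fun k => insert k (K k) :=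
        Finset.subset_biUnion_of_mem (fun k => insert k (K k)) hk
      rw [hpq]
      refine majoranaAlgebra_mono hsub (mul_mem (add_mem (Subalgebra.smul_mem _ (one_mem _) _)
        (Subalgebra.smul_mem _ (majoranaAlgebra_mono (Finset.subset_insert _ _)
          (majoranaString_mem_majoranaAlgebra _)) _))
        (majorana_mem_majoranaAlgebra (Finset.mem_insert_self _ _)))

/-- The two bounds concern opposite directions: degrees are followed under U · U†, for the
polynomial in the number operator, and supports under U† · U, for the measurement. Each layer costs
a factor of at most 5 in either case. -/
theorem IsCircuit.conj {T : ℕ} {U : Op M} (h : IsCircuit T U) : U ∈ unitary (Op M) ∧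
    (∀ k, U * majorana k * star U ∈ degLEOne M ^ 5 ^ T) ∧
    ∀ S : Finset (Fin (2 * M)), ∃ S' : Finset (Fin (2 * M)), S'.card ≤ 5 ^ T * S.card ∧
      ∀ A ∈ majoranaAlgebra S, star U * A * U ∈ majoranaAlgebra S' := by
  induction T generalizing U with
  | zero =>
    rw [IsCircuit] at h
    subst h
    refine ⟨one_mem _, fun k => ?_, fun S => ⟨S, by simp, by simp⟩⟩
    simpa using majorana_mem_degLEOne k
  | succ T ih =>
    obtain ⟨W, V, hW, hV, rfl⟩ := h
    obtain ⟨h1, h2, h3⟩ := ih hV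
    have hu := hW.conj_majorana.1
    refine ⟨mul_mem hu h1, fun k => ?_, fun S => ?_⟩
    · have := FNLTS.conj_mem_degLEOne_pow hu hW.conj_mem_degLEOne_pow (h2 k)
      rw [← pow_succ'] at this
      rw [star_mul]
      simpa only [mul_assoc] using this
    · obtain ⟨S₁, hc₁, hS₁⟩ := hW.exists_lightcone S
      obtain ⟨S₂, hc₂, hS₂⟩ := h3 S₁
      refine ⟨S₂, ?_, fun A hA => ?_⟩
      · calc S₂.card ≤ 5 ^ T * S₁.card := hc₂
          _ ≤ 5 ^ T * (5 * S.card) := Nat.mul_le_mul_left _ hc₁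
          _ = _ := by ring
      · have := hS₂ _ (hS₁ A hA)
        rw [star_mul]
        simpa only [mul_assoc] using this

/-! ### Gaussian circuits -/

theorem gaussian_sq {k l : Fin (2 * M)} (h : k ≠ l) (ω : ℝ) :
    (-(ω : ℂ) • (majorana k * majorana l)) * (-(ω : ℂ) • (majorana k * majorana l)) =
      (-(ω : ℂ) ^ 2) • (1 : Op M) := by
  rw [smul_mul_smul_comm, mul_assoc, majorana_mul_left_anticomm h.symm, majorana_mul_self, mul_one,
    mul_neg (majorana k), majorana_mul_self, smul_neg, ← neg_smul]
  congr 1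
  ring

theorem star_gaussian {k l : Fin (2 * M)} (h : k ≠ l) (ω : ℝ) :
    star (-(ω : ℂ) • (majorana k * majorana l)) = -(-(ω : ℂ) • (majorana k * majorana l)) := by
  rw [star_smul, star_mul, star_majorana, star_majorana, majorana_anticomm h.symm]
  simp

theorem star_mem_gaussianCircuits {G : Op M} (h : G ∈ gaussianCircuits M) :
    star G ∈ gaussianCircuits M := by
  induction h using Submonoid.closure_induction with
  | one => simp
  | mul A B _ _ hA hB => rw [star_mul]; exact mul_mem hB hA
  | mem G hG =>
    obtain ⟨k, l, ω, hkl, rfl⟩ := hG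
    refine Submonoid.subset_closure ⟨k, l, -ω, hkl, ?_⟩
    rw [Matrix.star_eq_conjTranspose, ← Matrix.exp_conjTranspose, ← Matrix.star_eq_conjTranspose,
      star_gaussian hkl]
    simp

/-- A generator only rotates the plane of its two Majorana operators and fixes the others. -/
theorem gaussianCircuits_conj {G : Op M} (h : G ∈ gaussianCircuits M) :
    G ∈ unitary (Op M) ∧ ∀ A ∈ linearSpan M, G * A * star G ∈ linearSpan M := by
  induction h using Submonoid.closure_induction with
  | one => exact ⟨one_mem _, by simp⟩
  | mul G G' _ _ hG hG' =>
    refine ⟨mul_mem hG.1 hG'.1, fun A hA => ?_⟩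
    have := hG.2 _ (hG'.2 A hA)
    rw [star_mul]
    simpa only [mul_assoc] using this
  | mem G hG =>
    obtain ⟨k, l, ω, hkl, rfl⟩ := hG
    refine ⟨exp_mem_unitary (star_gaussian hkl ω), fun A hA => ?_⟩
    induction hA using Submodule.span_induction with
    | zero => simp
    | add A B _ _ hA hB => rw [mul_add, add_mul]; exact add_mem hA hB
    | smul z A _ hA =>
      rw [mul_smul_comm, smul_mul_assoc]
      exact Submodule.smul_mem _ _ hA
    | mem A hA =>
      obtain ⟨j, rfl⟩ := hA
      by_cases hjk : j = k
      · subst hjk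
        have h1 : majorana j * majorana l * majorana j = -majorana l := by
          rw [mul_assoc, majorana_anticomm hkl.symm, mul_neg, ← mul_assoc, majorana_mul_self,
            one_mul]
        obtain ⟨p, q, hpq⟩ := exp_conj_of_anticomm (gaussian_sq hkl ω) (star_gaussian hkl ω)
          (A := majorana j) (by
            rw [smul_mul_assoc, mul_smul_comm, h1, ← mul_assoc, majorana_mul_self, one_mul,
              smul_neg])
        rw [hpq, add_mul, smul_mul_assoc, one_mul, smul_mul_assoc, smul_mul_assoc, h1]
        exact add_mem (Submodule.smul_mem _ _ (majorana_mem_linearSpan j))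
          (Submodule.smul_mem _ _ (Submodule.smul_mem _ _ (neg_mem (majorana_mem_linearSpan l))))
      by_cases hjl : j = l
      · subst hjl
        have h1 : majorana k * majorana j * majorana j = majorana k := by
          rw [mul_assoc, majorana_mul_self, mul_one]
        obtain ⟨p, q, hpq⟩ := exp_conj_of_anticomm (gaussian_sq hkl ω) (star_gaussian hkl ω)
          (A := majorana j) (by
            rw [smul_mul_assoc, mul_smul_comm, h1, ← mul_assoc, majorana_anticomm hkl.symm,
              neg_mul, h1, smul_neg, neg_neg])
        rw [hpq, add_mul, smul_mul_assoc, one_mul, smul_mul_assoc, smul_mul_assoc, h1]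
        exact add_mem (Submodule.smul_mem _ _ (majorana_mem_linearSpan j))
          (Submodule.smul_mem _ _ (Submodule.smul_mem _ _ (majorana_mem_linearSpan k)))
      · have hc : Commute (majorana k * majorana l) (majorana j) := by
          rw [commute_iff_eq, mul_assoc, majorana_anticomm (Ne.symm hjl), mul_neg, ← mul_assoc,
            majorana_anticomm (Ne.symm hjk), neg_mul, neg_neg, mul_assoc]
        rw [exp_conj_of_commute (gaussian_sq hkl ω) (star_gaussian hkl ω) (hc.smul_left _)]
        exact majorana_mem_linearSpan j

/-- Gaussian circuits preserve degree but not support, so the degree bound survives while the light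
cone is replaced by the algebra of all Majorana operators. -/
theorem IsGaussianAssistedCircuit.conj {T : ℕ} {U : Op M} (h : IsGaussianAssistedCircuit T U) :
    U ∈ unitary (Op M) ∧ (∀ k, U * majorana k * star U ∈ degLEOne M ^ 5 ^ T) ∧
      ∀ A ∈ majoranaAlgebra Finset.univ, star U * A * U ∈ majoranaAlgebra Finset.univ := by
  induction T generalizing U with
  | zero =>
    rw [IsGaussianAssistedCircuit] at h
    subst h
    refine ⟨one_mem _, fun k => ?_, by simp⟩
    simpa using majorana_mem_degLEOne k
  | succ T ih =>
    obtain ⟨G, W, V, hG, hW, hV, rfl⟩ := h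
    obtain ⟨h1, h2, h5⟩ := ih hV
    have hu := hW.conj_majorana.1
    have hGu := gaussianCircuits_conj hG
    refine ⟨mul_mem (mul_mem hGu.1 hu) h1, fun k => ?_, fun A hA => ?_⟩
    rotate_left
    · have hG' := gaussianCircuits_conj (star_mem_gaussianCircuits hG)
      have h3 := conj_mem_of_mem_majoranaAlgebra hG'.1 (fun k _ =>
        linearSpan_le_majoranaAlgebra (hG'.2 _ (majorana_mem_linearSpan k))) hA
      rw [star_star] at h3
      obtain ⟨S', -, hS'⟩ := hW.exists_lightcone Finset.univ
      have h4 := h5 _ (majoranaAlgebra_mono (Finset.subset_univ S') (hS' _ h3))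
      rw [star_mul, star_mul]
      simpa only [mul_assoc] using h4
    have h3 := FNLTS.conj_mem_degLEOne_pow hu hW.conj_mem_degLEOne_pow (h2 k)
    have h4 := FNLTS.conj_mem_degLEOne_pow hGu.1 (D := 1) (fun k => by
      rw [pow_one]
      exact (le_sup_right : linearSpan M ≤ degLEOne M) (hGu.2 _ (majorana_mem_linearSpan k))) h3
    rw [one_mul, ← pow_succ'] at h4
    rw [star_mul, star_mul]
    simpa only [mul_assoc] using h4

end

/-! ### Pure Gaussian states as fermionic vacua. -/

section

/-! ### Annihilation operators of a pure Gaussian state -/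

theorem IsCAR.map {A B F : Type*} [Ring A] [StarRing A] [Ring B] [StarRing B]
    [FunLike F A B] [RingHomClass F A B] [StarHomClass F A B]
    {κ : Type*} [DecidableEq κ] {a : κ → A} (ha : IsCAR a) (φ : F) : IsCAR fun i => φ (a i) where
  anti i j := by rw [← map_mul, ← map_mul, ← map_add, ha.anti, map_zero]
  mixed i j := by
    rw [← map_star, ← map_mul, ← map_mul, ← map_add, ha.mixed]
    split_ifs <;> simp

section Occupation

variable {M : ℕ} (s : Fin M → Fin 2)

/-- The annihilation operators of the occupation state. -/
def occupationAnnihilator (j : Fin M) : Op M :=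
  (2 : ℂ)⁻¹ • (majorana ⟨2 * j, by omega⟩ -
    ((-1 : ℂ) ^ (s j : ℕ) * Complex.I) • majorana ⟨2 * j + 1, by omega⟩)

theorem star_occupationAnnihilator (j : Fin M) :
    star (occupationAnnihilator s j) = (2 : ℂ)⁻¹ • (majorana ⟨2 * j, by omega⟩ +
      ((-1 : ℂ) ^ (s j : ℕ) * Complex.I) • majorana ⟨2 * j + 1, by omega⟩) := by
  simp [occupationAnnihilator, star_smul, star_majorana, sub_neg_eq_add]

theorem majorana_mul_add (k l : Fin (2 * M)) :
    majorana k * majorana l + majorana l * majorana k = if k = l then (2 : ℂ) • 1 else 0 := by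
  split_ifs with h
  · rw [h, majorana_mul_self, two_smul]
  · rw [majorana_anticomm h, neg_add_cancel]

theorem sign_mul_sign (a : Fin 2) : (-1 : ℂ) ^ (a : ℕ) * (-1 : ℂ) ^ (a : ℕ) = 1 := by
  rw [← mul_pow]; simp

/-- Covers both types of anticommutation relations: the coefficient 1 + xy vanishes for two
annihilation operators of the same mode and equals 2 for one and its adjoint. -/
theorem linearCombination_mul_add (i j : Fin M) (x y : ℂ) :
    (majorana ⟨2 * i, by omega⟩ + x • majorana ⟨2 * i + 1, by omega⟩) *
        (majorana ⟨2 * j, by omega⟩ + y • majorana ⟨2 * j + 1, by omega⟩) +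
      (majorana ⟨2 * j, by omega⟩ + y • majorana ⟨2 * j + 1, by omega⟩) *
        (majorana ⟨2 * i, by omega⟩ + x • majorana ⟨2 * i + 1, by omega⟩) =
      if i = j then (2 * (1 + x * y)) • (1 : Op M) else 0 := by
  have h1 := majorana_mul_add (M := M) ⟨2 * i, by omega⟩ ⟨2 * j, by omega⟩
  have h2 := majorana_mul_add (M := M) ⟨2 * i, by omega⟩ ⟨2 * j + 1, by omega⟩
  have h3 := majorana_mul_add (M := M) ⟨2 * i + 1, by omega⟩ ⟨2 * j, by omega⟩
  have h4 := majorana_mul_add (M := M) ⟨2 * i + 1, by omega⟩ ⟨2 * j + 1, by omega⟩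
  rw [if_neg (by simp only [Fin.mk.injEq]; omega)] at h2 h3
  simp only [add_mul, mul_add, smul_mul_assoc, mul_smul_comm]
  rw [add_eq_zero_iff_eq_neg] at h2 h3
  rw [h2, h3]
  by_cases hij : i = j
  · subst hij
    simp only [majorana_mul_self, if_true]
    module
  · have hij' : (i : ℕ) ≠ j := fun h => hij (Fin.ext h)
    rw [if_neg (by simp only [Fin.mk.injEq]; omega), add_eq_zero_iff_eq_neg] at h1 h4
    rw [h1, h4, if_neg hij]
    module

theorem isCAR_occupationAnnihilator : IsCAR (occupationAnnihilator s) where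
  anti i j := by
    have h := linearCombination_mul_add i j (-((-1 : ℂ) ^ (s i : ℕ) * Complex.I))
      (-((-1 : ℂ) ^ (s j : ℕ) * Complex.I))
    simp only [neg_smul, ← sub_eq_add_neg] at h
    simp only [occupationAnnihilator, smul_mul_smul_comm]
    rw [← smul_add, h]
    split_ifs with hij
    · subst hij
      rw [neg_mul_neg, mul_mul_mul_comm, sign_mul_sign, Complex.I_mul_I]
      simp
    · simp
  mixed i j := by
    have h := linearCombination_mul_add i j (-((-1 : ℂ) ^ (s i : ℕ) * Complex.I))
      ((-1 : ℂ) ^ (s j : ℕ) * Complex.I)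
    simp only [neg_smul, ← sub_eq_add_neg] at h
    rw [star_occupationAnnihilator]
    simp only [occupationAnnihilator, smul_mul_smul_comm]
    rw [← smul_add, h]
    split_ifs with hij
    · subst hij
      rw [neg_mul, mul_mul_mul_comm, sign_mul_sign, Complex.I_mul_I, smul_smul]
      norm_num
    · simp

theorem majorana_mem_span_occupationAnnihilator (k : Fin (2 * M)) :
    majorana k ∈ Submodule.span ℂ (Set.range (occupationAnnihilator s) ∪
      Set.range fun j => star (occupationAnnihilator s j)) := by
  have hk := k.2
  let j : Fin M := ⟨(k : ℕ) / 2, by omega⟩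
  have ha : occupationAnnihilator s j ∈ Submodule.span ℂ (Set.range (occupationAnnihilator s) ∪
      Set.range fun j => star (occupationAnnihilator s j)) :=
    Submodule.subset_span (Or.inl ⟨j, rfl⟩)
  have ha' : star (occupationAnnihilator s j) ∈ Submodule.span ℂ
      (Set.range (occupationAnnihilator s) ∪
        Set.range fun j => star (occupationAnnihilator s j)) :=
    Submodule.subset_span (Or.inr ⟨j, rfl⟩)
  rcases Nat.mod_two_eq_zero_or_one (k : ℕ) with h | h
  · have hk : k = ⟨2 * j, by omega⟩ := Fin.ext (by simp only [j]; omega)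
    have : majorana k = occupationAnnihilator s j + star (occupationAnnihilator s j) := by
      rw [star_occupationAnnihilator, occupationAnnihilator, ← hk]
      module
    rw [this]
    exact add_mem ha ha'
  · have hk : k = ⟨2 * j + 1, by omega⟩ := Fin.ext (by simp only [j]; omega)
    have hs := sign_mul_sign (s j)
    have : majorana k = ((-1 : ℂ) ^ (s j : ℕ) * Complex.I) •
        (occupationAnnihilator s j - star (occupationAnnihilator s j)) := by
      have e : ∀ (x : ℂ) (A B : Op M), x * x = -1 →
          x • ((2 : ℂ)⁻¹ • (A - x • B) - (2 : ℂ)⁻¹ • (A + x • B)) = B := by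
        intro x A B hx
        have : x • ((2 : ℂ)⁻¹ • (A - x • B) - (2 : ℂ)⁻¹ • (A + x • B)) = (-(x * x)) • B := by
          module
        rw [this, hx, neg_neg, one_smul]
      rw [star_occupationAnnihilator, occupationAnnihilator, ← hk, e]
      rw [mul_mul_mul_comm, hs, Complex.I_mul_I, one_mul]
    rw [this]
    exact Submodule.smul_mem _ _ (sub_mem ha ha')

/-- The projection onto a given occupation of mode `j`. -/
def occupationFactor (j : Fin M) : Op M :=
  (2 : ℂ)⁻¹ • (1 + ((-1 : ℂ) ^ (s j : ℕ) * Complex.I) •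
    (majorana ⟨2 * j, by omega⟩ * majorana ⟨2 * j + 1, by omega⟩))

theorem occupationState_eq : occupationState s = (List.ofFn (occupationFactor s)).prod := rfl

theorem commute_majorana_occupationFactor {j : Fin M} {k : Fin (2 * M)} (h : (k : ℕ) / 2 ≠ j) :
    Commute (majorana k) (occupationFactor s j) := by
  have h1 : k ≠ ⟨2 * j, by omega⟩ := fun h' => h (by rw [h']; simp)
  have h2 : k ≠ ⟨2 * j + 1, by omega⟩ := fun h' => h (by rw [h']; simp only; omega)
  refine ((Commute.one_right _).add_right (Commute.smul_right ?_ _)).smul_right _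
  rw [commute_iff_eq, ← mul_assoc, majorana_anticomm h1, neg_mul, mul_assoc, majorana_anticomm h2,
    mul_neg, neg_neg, mul_assoc]

theorem commute_occupationFactor (i j : Fin M) (h : i ≠ j) :
    Commute (occupationFactor s i) (occupationFactor s j) := by
  have h' : (i : ℕ) ≠ j := fun h'' => h (Fin.ext h'')
  refine ((Commute.one_left _).add_left (Commute.smul_left ?_ _)).smul_left _
  exact (commute_majorana_occupationFactor s (by simp only; omega)).mul_left
    (commute_majorana_occupationFactor s (by simp only; omega))

theorem star_occupationFactor (j : Fin M) : star (occupationFactor s j) = occupationFactor s j := by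
  have h : (⟨2 * j + 1, by omega⟩ : Fin (2 * M)) ≠ ⟨2 * j, by omega⟩ := by simp
  simp [occupationFactor, star_smul, star_add, star_mul, star_majorana, majorana_anticomm h,
    mul_comm Complex.I]

theorem occupationFactor_mul_self (j : Fin M) :
    occupationFactor s j * occupationFactor s j = occupationFactor s j := by
  have h : (⟨2 * j + 1, by omega⟩ : Fin (2 * M)) ≠ ⟨2 * j, by omega⟩ := by simp
  have h2 : (majorana (⟨2 * j, by omega⟩ : Fin (2 * M)) * majorana ⟨2 * j + 1, by omega⟩) *
      (majorana ⟨2 * j, by omega⟩ * majorana ⟨2 * j + 1, by omega⟩) = -1 := by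
    rw [mul_assoc, majorana_mul_left_anticomm h, majorana_mul_self, mul_one, mul_neg,
      majorana_mul_self]
  have h3 : (((-1 : ℂ) ^ (s j : ℕ) * Complex.I) • (majorana (⟨2 * j, by omega⟩ : Fin (2 * M)) *
      majorana ⟨2 * j + 1, by omega⟩)) * (((-1 : ℂ) ^ (s j : ℕ) * Complex.I) •
      (majorana ⟨2 * j, by omega⟩ * majorana ⟨2 * j + 1, by omega⟩)) = 1 := by
    rw [smul_mul_smul_comm, h2, mul_mul_mul_comm, sign_mul_sign, Complex.I_mul_I]
    simp
  rw [occupationFactor, smul_mul_smul_comm, add_mul, mul_add, mul_add, h3, one_mul, one_mul,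
    mul_one]
  module

theorem occupationAnnihilator_mul_factor (j : Fin M) :
    occupationAnnihilator s j * occupationFactor s j = 0 := by
  have h : (⟨2 * j + 1, by omega⟩ : Fin (2 * M)) ≠ ⟨2 * j, by omega⟩ := by simp
  have hs := sign_mul_sign (s j)
  have h1 : majorana (⟨2 * j + 1, by omega⟩ : Fin (2 * M)) * (majorana ⟨2 * j, by omega⟩ *
      majorana ⟨2 * j + 1, by omega⟩) = -majorana ⟨2 * j, by omega⟩ := by
    rw [majorana_mul_left_anticomm h, majorana_mul_self, mul_one]
  rw [occupationAnnihilator, occupationFactor, smul_mul_smul_comm, sub_mul, mul_add, mul_one,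
    mul_smul_comm, majorana_mul_left_self, mul_add, mul_one, smul_mul_smul_comm, h1,
    mul_mul_mul_comm, hs, Complex.I_mul_I]
  module

theorem mul_list_prod_eq_zero {R : Type*} [Ring R] {x : R} {l : List R}
    (h : ∀ y ∈ l, x * y = 0 ∨ Commute x y) (h0 : ∃ y ∈ l, x * y = 0) : x * l.prod = 0 := by
  induction l with
  | nil => simp at h0
  | cons y l ih =>
    rw [List.prod_cons, ← mul_assoc]
    rcases h y (by simp) with hy | hy
    · rw [hy, zero_mul]
    · by_cases hxy : x * y = 0
      · rw [hxy, zero_mul]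
      · obtain ⟨z, hz, hxz⟩ := h0
        rw [hy.eq, mul_assoc, ih (fun y' hy' => h y' (List.mem_cons_of_mem _ hy')), mul_zero]
        rcases List.mem_cons.1 hz with rfl | hz
        · exact absurd hxz hxy
        · exact ⟨z, hz, hxz⟩

theorem occupationAnnihilator_mul_state (j : Fin M) :
    occupationAnnihilator s j * occupationState s = 0 := by
  rw [occupationState_eq]
  refine mul_list_prod_eq_zero (fun y hy => ?_)
    ⟨_, (List.mem_ofFn' _ _).2 ⟨j, rfl⟩, occupationAnnihilator_mul_factor s j⟩
  obtain ⟨i, rfl⟩ := (List.mem_ofFn' _ _).1 hy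
  by_cases hij : i = j
  · left
    rw [hij, occupationAnnihilator_mul_factor]
  · have hij' : (i : ℕ) ≠ j := fun h => hij (Fin.ext h)
    right
    exact ((commute_majorana_occupationFactor s (by simp only; omega)).sub_left
      ((commute_majorana_occupationFactor s (by simp only; omega)).smul_left _)).smul_left _

theorem star_occupationState : star (occupationState s) = occupationState s := by
  rw [occupationState_eq, star_prod_ofFn _ (commute_occupationFactor s)]
  simp only [star_occupationFactor]

theorem occupationState_mul_self : occupationState s * occupationState s = occupationState s := by
  rw [occupationState_eq, prod_ofFn_mul_prod_ofFn _ _ (commute_occupationFactor s)]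
  simp only [occupationFactor_mul_self]

/-- The Z strings of the two operators cancel, and XY = iZ remains at site `j`. -/
theorem majorana_mul_majorana_eq_diagonal (j : Fin M) :
    majorana (⟨2 * j, by omega⟩ : Fin (2 * M)) * majorana ⟨2 * j + 1, by omega⟩ =
      Matrix.diagonal fun t => (![Complex.I, -Complex.I] : Fin 2 → ℂ) (t j) := by
  have h : ∀ i : Fin M, (if (i : ℕ) < (2 * j : ℕ) / 2 then pauliZ else if (i : ℕ) = (2 * j : ℕ) / 2
      then (if (2 * j : ℕ) % 2 = 0 then pauliX else pauliY) else 1) *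
      (if (i : ℕ) < (2 * j + 1 : ℕ) / 2 then pauliZ else if (i : ℕ) = (2 * j + 1 : ℕ) / 2
      then (if (2 * j + 1 : ℕ) % 2 = 0 then pauliX else pauliY) else 1) =
      Matrix.diagonal (if i = j then ![Complex.I, -Complex.I] else 1) := by
    intro i
    have e1 : (2 * j : ℕ) / 2 = j := by omega
    have e2 : (2 * j + 1 : ℕ) / 2 = j := by omega
    have e3 : (2 * j : ℕ) % 2 = 0 := by omega
    have e4 : (2 * j + 1 : ℕ) % 2 ≠ 0 := by omega
    rw [e1, e2, if_pos e3, if_neg e4]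
    rcases lt_trichotomy (i : ℕ) j with hij | hij | hij
    · have : i ≠ j := fun h => by rw [h] at hij; exact lt_irrefl _ hij
      simp [hij, this, pauliZ_mul_self]
    · have : i = j := Fin.ext hij
      subst this
      simp only [lt_irrefl, if_false, if_true]
      ext a b
      fin_cases a <;> fin_cases b <;> simp [pauliX, pauliY]
    · have : i ≠ j := fun h => by rw [h] at hij; exact lt_irrefl _ hij
      simp [hij.not_gt, hij.ne', this]
  rw [majorana, majorana, tensorOp_mul]
  simp only [h]
  ext t u
  simp only [tensorOp, Matrix.of_apply, Matrix.diagonal_apply]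
  rw [Finset.prod_ite_zero]
  by_cases htu : t = u
  · subst htu
    rw [if_pos (by simp), if_pos rfl]
    rw [Finset.prod_eq_single_of_mem j (Finset.mem_univ j) fun i _ hij => by simp [hij]]
    simp
  · rw [if_neg htu, if_neg]
    intro h'
    exact htu (funext fun i => h' i (Finset.mem_univ i))

/-- All factors are diagonal, so the trace is a product over modes; in each mode the two diagonal
values add up to one. -/
theorem occupationState_trace : (occupationState s).trace = 1 := by
  have h : ∀ j : Fin M, occupationFactor s j = Matrix.diagonalRingHom (Fin M → Fin 2) ℂ fun t =>
      (2 : ℂ)⁻¹ * (1 + ((-1 : ℂ) ^ (s j : ℕ) * Complex.I) *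
        (![Complex.I, -Complex.I] : Fin 2 → ℂ) (t j)) := by
    intro j
    rw [occupationFactor, majorana_mul_majorana_eq_diagonal, ← Matrix.diagonal_one,
      ← Matrix.diagonal_smul, Matrix.diagonal_add, ← Matrix.diagonal_smul]
    rfl
  have h2 : occupationState s = Matrix.diagonal (∏ j : Fin M, fun t : Fin M → Fin 2 =>
      (2 : ℂ)⁻¹ * (1 + ((-1 : ℂ) ^ (s j : ℕ) * Complex.I) *
        (![Complex.I, -Complex.I] : Fin 2 → ℂ) (t j))) := by
    rw [occupationState_eq, funext h, ← List.prod_ofFn, ← Matrix.diagonalRingHom_apply,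
      map_list_prod, List.map_ofFn]
    rfl
  rw [h2, Matrix.trace_diagonal]
  simp only [Finset.prod_apply]
  have h3 := Finset.prod_univ_sum (fun _ : Fin M => (Finset.univ : Finset (Fin 2)))
    (fun j x => (2 : ℂ)⁻¹ * (1 + ((-1 : ℂ) ^ (s j : ℕ) * Complex.I) *
        (![Complex.I, -Complex.I] : Fin 2 → ℂ) x))
  rw [Fintype.piFinset_univ] at h3
  rw [← h3]
  refine Finset.prod_eq_one fun j _ => ?_
  rw [Fin.sum_univ_two]
  simp only [Matrix.cons_val_zero, Matrix.cons_val_one]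
  ring

end Occupation

/-- The annihilation operators of the occupation state are conjugated by `G`. Linearity in the
Majorana operators survives because Gaussian conjugation preserves their span. -/
theorem IsPureGaussian.exists_annihilators {M : ℕ} {σ : Op M} (h : IsPureGaussian σ) :
    star σ = σ ∧ σ * σ = σ ∧ σ.trace = 1 ∧ ∃ a : Fin M → Op M, IsCAR a ∧ (∀ j, a j * σ = 0) ∧
      (∀ k, majorana k ∈ Submodule.span ℂ (Set.range a ∪ Set.range fun j => star (a j))) ∧
      ∀ j, a j ∈ linearSpan M := by
  obtain ⟨G, hG, s, rfl⟩ := h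
  obtain ⟨hu, hlin⟩ := gaussianCircuits_conj hG
  obtain ⟨-, hlin'⟩ := gaussianCircuits_conj (star_mem_gaussianCircuits hG)
  rw [← Matrix.star_eq_conjTranspose, ← conjHom_apply hu]
  have hinv : ∀ A : Op M, conjHom hu (star G * A * G) = A := by
    intro A
    have h1 : G * star G = 1 := (Unitary.mem_iff.1 hu).2
    rw [conjHom_apply]
    calc G * (star G * A * G) * star G = (G * star G) * A * (G * star G) := by
          simp only [mul_assoc]
      _ = A := by rw [h1, one_mul, mul_one]
  refine ⟨by rw [← map_star, star_occupationState], by rw [← map_mul, occupationState_mul_self],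
    ?_, fun j => conjHom hu (occupationAnnihilator s j), (isCAR_occupationAnnihilator s).map _,
    fun j => by rw [← map_mul, occupationAnnihilator_mul_state, map_zero], fun k => ?_,
    fun j => ?_⟩
  · rw [conjHom_apply, Matrix.trace_mul_comm, ← mul_assoc, (Unitary.mem_iff.1 hu).1, one_mul,
      occupationState_trace]
  · have hmem : ∀ A ∈ linearSpan M, A ∈ Submodule.span ℂ (Set.range (occupationAnnihilator s) ∪
        Set.range fun j => star (occupationAnnihilator s j)) := by
      intro A hA
      refine (Submodule.span_le.2 ?_ : linearSpan M ≤ _) hA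
      rintro _ ⟨k, rfl⟩
      exact majorana_mem_span_occupationAnnihilator s k
    have h1 := hlin' _ (majorana_mem_linearSpan k)
    rw [star_star] at h1
    have h2 := Submodule.mem_map_of_mem
      (f := (conjHom hu : Op M →ₐ[ℂ] Op M).toLinearMap) (hmem _ h1)
    rw [Submodule.map_span] at h2
    have h3 : (conjHom hu : Op M →ₐ[ℂ] Op M).toLinearMap (star G * majorana k * G) = majorana k :=
      hinv _
    rw [h3] at h2
    refine Submodule.span_mono ?_ h2
    rintro _ ⟨_, ⟨j, rfl⟩ | ⟨j, rfl⟩, rfl⟩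
    · exact Or.inl ⟨j, rfl⟩
    · exact Or.inr ⟨j, (map_star (conjHom hu) _).symm⟩
  · exact hlin _ (Submodule.smul_mem _ _ (sub_mem (majorana_mem_linearSpan _)
      (Submodule.smul_mem _ _ (majorana_mem_linearSpan _))))

end

/-! ### Ancillary modes, the embedded measurement and the depth bound. -/

section

/-! ### Ancillary modes -/

/-- The embedding `A ↦ A ⊗ 1` of the operators on `N` modes into those on `N + m` modes. -/
def ancillaHom (N m : ℕ) : Op N →ₐ[ℂ] Op (N + m) :=
  AlgHom.ofLinearMap
    { toFun := fun A => (Matrix.kroneckerMap (· * ·) A (1 : Op m)).submatrix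
        (Fin.appendEquiv N m).symm (Fin.appendEquiv N m).symm
      map_add' := fun A B => by
        ext x y
        simp [Matrix.kroneckerMap_apply, add_mul]
      map_smul' := fun z A => by
        ext x y
        simp [Matrix.kroneckerMap_apply, mul_assoc] }
    (by
      change (Matrix.kroneckerMap (· * ·) (1 : Op N) (1 : Op m)).submatrix _ _ = 1
      rw [Matrix.one_kronecker_one, Matrix.submatrix_one_equiv])
    (fun A B => by
      change (Matrix.kroneckerMap (· * ·) (A * B) (1 : Op m)).submatrix _ _ =
        (Matrix.kroneckerMap (· * ·) A (1 : Op m)).submatrix _ _ *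
          (Matrix.kroneckerMap (· * ·) B (1 : Op m)).submatrix _ _
      rw [Matrix.submatrix_mul_equiv, ← Matrix.mul_kronecker_mul, one_mul])

variable {N m : ℕ}

theorem ancillaHom_apply (A : Op N) (s t : Fin N → Fin 2) (u v : Fin m → Fin 2) :
    ancillaHom N m A (Fin.append s u) (Fin.append t v) = A s t * (1 : Op m) u v := by
  have h : ∀ (s : Fin N → Fin 2) (u : Fin m → Fin 2),
      (Fin.appendEquiv N m).symm (Fin.append s u) = (s, u) := fun s u =>
    (Fin.appendEquiv N m).symm_apply_apply (s, u)
  change (Matrix.kroneckerMap (· * ·) A (1 : Op m)).submatrix _ _ _ _ = _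
  rw [Matrix.submatrix_apply, h, h, Matrix.kroneckerMap_apply]

theorem append_ext {A B : Op (N + m)}
    (h : ∀ s t u v, A (Fin.append s u) (Fin.append t v) = B (Fin.append s u) (Fin.append t v)) :
    A = B := by
  ext x y
  obtain ⟨⟨s, u⟩, rfl⟩ := (Fin.appendEquiv N m).surjective x
  obtain ⟨⟨t, v⟩, rfl⟩ := (Fin.appendEquiv N m).surjective y
  exact h s t u v

theorem ancillaHom_star (A : Op N) : ancillaHom N m (star A) = star (ancillaHom N m A) := by
  refine append_ext fun s t u v => ?_
  rw [Matrix.star_apply, ancillaHom_apply, ancillaHom_apply, star_mul', Matrix.star_apply,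
    ← Matrix.star_apply (1 : Op m), star_one]

/-- The partial trace is dual to A ↦ A ⊗ 1. -/
theorem trace_ancillaHom_mul (B : Op N) (A : Op (N + m)) :
    (ancillaHom N m B * A).trace = (B * traceAncillas m A).trace := by
  have hsum : ∀ f : (Fin (N + m) → Fin 2) → ℂ,
      ∑ x, f x = ∑ s : Fin N → Fin 2, ∑ u : Fin m → Fin 2, f (Fin.append s u) := by
    intro f
    rw [← (Fin.appendEquiv N m).sum_comp, Fintype.sum_prod_type]
    rfl
  simp only [Matrix.trace, Matrix.diag_apply, Matrix.mul_apply, hsum, ancillaHom_apply,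
    traceAncillas, Matrix.of_apply, Matrix.one_apply, mul_ite, mul_one, mul_zero, ite_mul, zero_mul,
    Finset.sum_ite_eq, Finset.mem_univ, if_true, Finset.mul_sum]
  exact Finset.sum_congr rfl fun s _ => Finset.sum_comm

/-- The index of a Majorana operator of the first `N` modes among all `N + m` modes. -/
def systemIndex (m : ℕ) (k : Fin (2 * N)) : Fin (2 * (N + m)) := ⟨k, by omega⟩

theorem systemIndex_injective : Function.Injective (systemIndex (N := N) m) := fun k l h => by
  rw [systemIndex, systemIndex, Fin.mk.injEq] at h
  exact Fin.ext h

/-- The Jordan–Wigner strings run over earlier modes, so with the ancillas placed last the system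
operators act as the identity on them. -/
theorem ancillaHom_majorana (k : Fin (2 * N)) :
    ancillaHom N m (majorana k) = majorana (systemIndex m k) := by
  refine append_ext fun s t u v => ?_
  rw [ancillaHom_apply]
  simp only [majorana, tensorOp, Matrix.of_apply, Fin.prod_univ_add, Fin.append_left,
    Fin.append_right, Fin.val_castAdd, Fin.val_natAdd, systemIndex]
  congr 1
  rw [← tensorOp_one]
  simp only [tensorOp, Matrix.of_apply]
  refine Finset.prod_congr rfl fun j _ => ?_
  have := k.2
  refine congrFun (congrFun (?_ : (1 : Matrix (Fin 2) (Fin 2) ℂ) = _) (u j)) (v j)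
  exact ((if_neg (show ¬ N + (j : ℕ) < (k : ℕ) / 2 by omega)).trans
    (if_neg (show ¬ N + (j : ℕ) = (k : ℕ) / 2 by omega))).symm

/-- The indices of the Majorana operators of the first `N` modes. -/
def systemIndices (N m : ℕ) : Finset (Fin (2 * (N + m))) := Finset.univ.image (systemIndex m)

theorem card_systemIndices_le : (systemIndices N m).card ≤ 2 * N :=
  Finset.card_image_le.trans (by simp)

variable {n : ℕ} (e : Fin n × Fin 3 ≃ Fin (2 * N))

/-- The embedding of the qubit operators into the fermionic operators with ancillary modes. -/
def embed (m : ℕ) (A : Op n) : Op (N + m) := ancillaHom N m (toFermions e A)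

theorem embed_mul (A B : Op n) : embed e m (A * B) = embed e m A * embed e m B := by
  rw [embed, toFermions_mul, map_mul]; rfl

theorem embed_one : embed e m 1 = 1 := by rw [embed, toFermions_one, map_one]

theorem embed_zero : embed e m 0 = 0 := by
  rw [embed, ← toFermionsLinear_apply, map_zero, map_zero]

theorem embed_sum {κ : Type*} (s : Finset κ) (A : κ → Op n) :
    embed e m (∑ i ∈ s, A i) = ∑ i ∈ s, embed e m (A i) := by
  rw [embed, ← toFermionsLinear_apply, map_sum, map_sum]; rfl

theorem embed_star (A : Op n) : embed e m (star A) = star (embed e m A) := by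
  rw [embed, toFermions_star, ancillaHom_star]; rfl

theorem embed_mem_majoranaAlgebra (A : Op n) : embed e m A ∈ majoranaAlgebra (systemIndices N m) := by
  have hmem : ∀ k, ancillaHom N m (majorana k) ∈ majoranaAlgebra (systemIndices N m) := fun k => by
    rw [ancillaHom_majorana]
    exact majorana_mem_majoranaAlgebra (Finset.mem_image_of_mem _ (Finset.mem_univ k))
  have himg : ∀ j p, ancillaHom N m (pauliImage e j p) ∈ majoranaAlgebra (systemIndices N m) := by
    intro j p
    have h2 : ∀ k l, ancillaHom N m (Complex.I • (majorana k * majorana l)) ∈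
        majoranaAlgebra (systemIndices N m) := fun k l => by
      rw [map_smul, map_mul]
      exact Subalgebra.smul_mem _ (mul_mem (hmem k) (hmem l)) _
    fin_cases p
    · change ancillaHom N m 1 ∈ _
      rw [map_one]
      exact one_mem _
    · exact h2 _ _
    · exact h2 _ _
    · exact h2 _ _
  rw [embed, toFermions, map_sum]
  refine sum_mem fun P _ => ?_
  rw [map_smul, map_list_prod]
  refine Subalgebra.smul_mem _ (list_prod_mem fun B hB => ?_) _
  obtain ⟨C, hC, rfl⟩ := List.mem_map.1 hB
  obtain ⟨j, rfl⟩ := (List.mem_ofFn' _ _).1 hC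
  exact himg _ _

theorem ancillaHom_siteMap_commute (j : Fin n) (A : Matrix (Fin 2) (Fin 2) ℂ)
    {k : Fin (2 * (N + m))} (hk : ∀ a, k ≠ systemIndex m (e (j, a))) :
    Commute (ancillaHom N m (siteMap e j A)) (majorana k) := by
  have h : ∀ a b, Commute (ancillaHom N m (Complex.I • (majorana (e (j, a)) * majorana (e (j, b)))))
      (majorana k) := by
    intro a b
    rw [map_smul, map_mul, ancillaHom_majorana, ancillaHom_majorana]
    refine Commute.smul_left ?_ _
    rw [commute_iff_eq, mul_assoc, majorana_anticomm (hk b).symm, mul_neg, ← mul_assoc,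
      majorana_anticomm (hk a).symm, neg_mul, neg_neg, mul_assoc]
  rw [siteMap_apply, map_sum]
  refine Commute.sum_left _ _ _ fun p _ => ?_
  rw [map_smul]
  refine Commute.smul_left ?_ _
  fin_cases p
  · change Commute (ancillaHom N m 1) _
    rw [map_one]
    exact Commute.one_left _
  · exact h 1 2
  · exact h 0 2
  · exact h 0 1

theorem embed_site_commute (j : Fin n) (A : Matrix (Fin 2) (Fin 2) ℂ)
    {k : Fin (2 * (N + m))} (hk : ∀ a, k ≠ systemIndex m (e (j, a))) :
    Commute (embed e m (tensorOp (Function.update (fun _ => 1) j A))) (majorana k) := by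
  rw [embed, toFermions_tensorOp, map_list_prod]
  refine Commute.list_prod_left _ _ fun B hB => ?_
  obtain ⟨C, hC, rfl⟩ := List.mem_map.1 hB
  obtain ⟨i, rfl⟩ := (List.mem_ofFn' _ _).1 hC
  by_cases hij : i = j
  · subst hij
    simp only [Function.update_self]
    exact ancillaHom_siteMap_commute e i A hk
  · simp only [Function.update_of_ne hij, siteMap_one, map_one]
    exact Commute.one_left _

/-! ### The product measurement -/

/-- The projection onto the outcome `a` of a single-qubit measurement. -/
def siteProj (V : Matrix.unitaryGroup (Fin 2) ℂ) (a : Fin 2) : Matrix (Fin 2) (Fin 2) ℂ :=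
  star (V : Matrix (Fin 2) (Fin 2) ℂ) * ((2 : ℂ)⁻¹ • (1 + (-1 : ℂ) ^ (a : ℕ) • pauliZ)) * V

theorem zProj_mul (a b : Fin 2) :
    ((2 : ℂ)⁻¹ • (1 + (-1 : ℂ) ^ (a : ℕ) • pauliZ)) * ((2 : ℂ)⁻¹ • (1 + (-1 : ℂ) ^ (b : ℕ) • pauliZ)) =
      if a = b then (2 : ℂ)⁻¹ • (1 + (-1 : ℂ) ^ (a : ℕ) • pauliZ) else 0 := by
  ext i j
  fin_cases a <;> fin_cases b <;> fin_cases i <;> fin_cases j <;>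
    simp [pauliZ, Matrix.mul_apply] <;> norm_num

theorem zProj_sum : ∑ a : Fin 2, (2 : ℂ)⁻¹ • (1 + (-1 : ℂ) ^ (a : ℕ) • pauliZ) = 1 := by
  rw [Fin.sum_univ_two]
  simp only [Fin.val_zero, Fin.val_one]
  module

theorem siteProj_mul (V : Matrix.unitaryGroup (Fin 2) ℂ) (a b : Fin 2) :
    siteProj V a * siteProj V b = if a = b then siteProj V a else 0 := by
  have hV : (V : Matrix (Fin 2) (Fin 2) ℂ) * star (V : Matrix (Fin 2) (Fin 2) ℂ) = 1 :=
    (Unitary.mem_iff.1 V.2).2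
  have h : siteProj V a * siteProj V b = star (V : Matrix (Fin 2) (Fin 2) ℂ) *
      (((2 : ℂ)⁻¹ • (1 + (-1 : ℂ) ^ (a : ℕ) • pauliZ)) *
        ((2 : ℂ)⁻¹ • (1 + (-1 : ℂ) ^ (b : ℕ) • pauliZ))) * V := by
    simp only [siteProj, mul_assoc]
    rw [← mul_assoc (V : Matrix (Fin 2) (Fin 2) ℂ) (star _), hV, one_mul]
  rw [h, zProj_mul]
  split_ifs
  · rfl
  · simp

theorem siteProj_sum (V : Matrix.unitaryGroup (Fin 2) ℂ) : ∑ a, siteProj V a = 1 := by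
  simp only [siteProj]
  rw [← Finset.sum_mul, ← Finset.mul_sum, zProj_sum, mul_one, (Unitary.mem_iff.1 V.2).1]

theorem siteProj_star (V : Matrix.unitaryGroup (Fin 2) ℂ) (a : Fin 2) :
    star (siteProj V a) = siteProj V a := by
  have hZ : star pauliZ = pauliZ := pauliZ_conjTranspose
  simp [siteProj, star_mul, star_smul, hZ, mul_assoc]

theorem productPOVM_eq (V : Fin n → Matrix.unitaryGroup (Fin 2) ℂ) (s : Fin n → Fin 2) :
    productPOVM V s = tensorOp fun j => siteProj (V j) (s j) := by
  rw [productPOVM, tensorOp_conjTranspose, tensorOp_mul, tensorOp_mul]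
  rfl

theorem productPOVM_star (V : Fin n → Matrix.unitaryGroup (Fin 2) ℂ) (s : Fin n → Fin 2) :
    star (productPOVM V s) = productPOVM V s := by
  rw [productPOVM_eq, Matrix.star_eq_conjTranspose, tensorOp_conjTranspose]
  simp only [← Matrix.star_eq_conjTranspose, siteProj_star]

theorem tensorOp_eq_zero {A : Fin n → Matrix (Fin 2) (Fin 2) ℂ} (j : Fin n) (h : A j = 0) :
    tensorOp A = 0 := by
  ext s t
  exact Finset.prod_eq_zero (Finset.mem_univ j) (by rw [h]; rfl)

theorem productPOVM_mul (V : Fin n → Matrix.unitaryGroup (Fin 2) ℂ) (s t : Fin n → Fin 2) :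
    productPOVM V s * productPOVM V t = if s = t then productPOVM V s else 0 := by
  rw [productPOVM_eq, productPOVM_eq, tensorOp_mul]
  split_ifs with h
  · subst h
    simp [siteProj_mul]
  · obtain ⟨j, hj⟩ := Function.ne_iff.1 h
    exact tensorOp_eq_zero j (by rw [siteProj_mul, if_neg hj])

theorem productPOVM_sum (V : Fin n → Matrix.unitaryGroup (Fin 2) ℂ) :
    ∑ s, productPOVM V s = 1 := by
  simp only [productPOVM_eq]
  rw [← tensorOp_one]
  ext a b
  have h : ∀ j, (1 : Matrix (Fin 2) (Fin 2) ℂ) (a j) (b j) =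
      ∑ c, siteProj (V j) c (a j) (b j) := fun j => by
    rw [← Matrix.sum_apply, siteProj_sum]
  simp only [Matrix.sum_apply, tensorOp, Matrix.of_apply, h]
  rw [Finset.prod_univ_sum, Fintype.piFinset_univ]

theorem productPOVM_mul_site (V : Fin n → Matrix.unitaryGroup (Fin 2) ℂ) (s : Fin n → Fin 2)
    (j : Fin n) :
    productPOVM V s * tensorOp (Function.update (fun _ => 1) j (siteProj (V j) (s j))) =
      productPOVM V s := by
  rw [productPOVM_eq, tensorOp_mul]
  congr 1
  funext i
  by_cases hij : i = j
  · subst hij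
    simp [siteProj_mul]
  · simp [Function.update_of_ne hij]

theorem site_mul_productPOVM (V : Fin n → Matrix.unitaryGroup (Fin 2) ℂ) (s t : Fin n → Fin 2)
    {j : Fin n} (h : s j ≠ t j) :
    tensorOp (Function.update (fun _ => 1) j (siteProj (V j) (s j))) * productPOVM V t = 0 := by
  rw [productPOVM_eq, tensorOp_mul]
  exact tensorOp_eq_zero j (by rw [Function.update_self, siteProj_mul, if_neg h])

/-- The strings differ at two sites or more, and `k` belongs to at most one. At another such site
the single-site projection commutes with the Majorana operator and meets an orthogonal one. -/
theorem embed_povm_mul_majorana_mul (V : Fin n → Matrix.unitaryGroup (Fin 2) ℂ)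
    {s t : Fin n → Fin 2} (h : 1 < hammingDist s t) (k : Fin (2 * (N + m))) :
    embed e m (productPOVM V s) * majorana k * embed e m (productPOVM V t) = 0 := by
  obtain ⟨j₁, h₁, j₂, h₂, h12⟩ := Finset.one_lt_card.1 h
  simp only [Finset.mem_filter, Finset.mem_univ, true_and] at h₁ h₂
  obtain ⟨j, hj, hk⟩ : ∃ j, s j ≠ t j ∧ ∀ a, k ≠ systemIndex m (e (j, a)) := by
    by_cases hk : ∀ a, k ≠ systemIndex m (e (j₁, a))
    · exact ⟨j₁, h₁, hk⟩
    · refine ⟨j₂, h₂, fun b hb => ?_⟩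
      push Not at hk
      obtain ⟨a, ha⟩ := hk
      have := e.injective (systemIndex_injective (ha.symm.trans hb))
      exact h12 (Prod.mk.inj this).1
  rw [← productPOVM_mul_site V s j, embed_mul, mul_assoc (embed e m (productPOVM V s)),
    (embed_site_commute e j _ hk).eq, mul_assoc, mul_assoc, ← embed_mul,
    site_mul_productPOVM V s t hj, embed_zero, mul_zero, mul_zero]

theorem embed_povm_mul_of_ne (V : Fin n → Matrix.unitaryGroup (Fin 2) ℂ) {s t : Fin n → Fin 2}
    (h : s ≠ t) : embed e m (productPOVM V s) * embed e m (productPOVM V t) = 0 := by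
  rw [← embed_mul, productPOVM_mul, if_neg h, embed_zero]

theorem embed_povm_mul_degLEOne_mul (V : Fin n → Matrix.unitaryGroup (Fin 2) ℂ)
    {s t : Fin n → Fin 2} (h : 1 < hammingDist s t) {X : Op (N + m)} (hX : X ∈ degLEOne (N + m)) :
    embed e m (productPOVM V s) * X * embed e m (productPOVM V t) = 0 := by
  obtain ⟨Y, hY, Z, hZ, rfl⟩ := Submodule.mem_sup.1 hX
  rw [mul_add, add_mul]
  have hst : s ≠ t := fun h' => by simp [h'] at h
  have h1 : embed e m (productPOVM V s) * Y * embed e m (productPOVM V t) = 0 := by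
    obtain ⟨z, rfl⟩ := Submodule.mem_one.1 hY
    rw [Algebra.algebraMap_eq_smul_one, mul_smul_comm, mul_one, smul_mul_assoc,
      embed_povm_mul_of_ne e V hst, smul_zero]
  have h2 : embed e m (productPOVM V s) * Z * embed e m (productPOVM V t) = 0 := by
    clear hX
    induction hZ using Submodule.span_induction with
    | zero => simp
    | add A B _ _ hA hB => rw [mul_add, add_mul, hA, hB, add_zero]
    | smul z A _ hA => rw [mul_smul_comm, smul_mul_assoc, hA, smul_zero]
    | mem A hA =>
      obtain ⟨k, rfl⟩ := hA
      exact embed_povm_mul_majorana_mul e V h k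
  rw [h1, h2, add_zero]

/-- A polynomial of degree d moves outcomes by Hamming distance at most d. One linear factor is
split off by inserting the resolution of the identity over intermediate outcomes `u`. -/
theorem embed_povm_mul_mul_eq_zero (V : Fin n → Matrix.unitaryGroup (Fin 2) ℂ) {d : ℕ}
    {s t : Fin n → Fin 2} (h : d < hammingDist s t) {X : Op (N + m)}
    (hX : X ∈ degLEOne (N + m) ^ d) :
    embed e m (productPOVM V s) * X * embed e m (productPOVM V t) = 0 := by
  induction d generalizing s t X with
  | zero =>
    have hst : s ≠ t := fun h' => by simp [h'] at h
    rw [pow_zero] at hX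
    obtain ⟨z, rfl⟩ := Submodule.mem_one.1 hX
    rw [Algebra.algebraMap_eq_smul_one, mul_smul_comm, mul_one, smul_mul_assoc,
      embed_povm_mul_of_ne e V hst, smul_zero]
  | succ d ih =>
    rw [pow_succ] at hX
    induction hX using Submodule.mul_induction_on' with
    | mem_mul_mem Y hY Z hZ =>
      have hone : Y * Z = ∑ u, Y * embed e m (productPOVM V u) * Z := by
        rw [← Finset.sum_mul, ← Finset.mul_sum, ← embed_sum, productPOVM_sum, embed_one, mul_one]
      rw [hone, Finset.mul_sum, Finset.sum_mul]
      refine Finset.sum_eq_zero fun u _ => ?_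
      by_cases hu : d < hammingDist s u
      · rw [mul_assoc Y, ← mul_assoc, ← mul_assoc, ih hu hY, zero_mul, zero_mul]
      -- If `u` is within d of `s`, the triangle inequality leaves more than one step to `t`.
      · have hut : 1 < hammingDist u t := by
          have := hammingDist_triangle s u t
          omega
        rw [mul_assoc Y, ← mul_assoc, mul_assoc, embed_povm_mul_degLEOne_mul e V hut hZ, mul_zero]
    | add Y _ Z _ hY hZ => rw [mul_add, add_mul, hY, hZ, add_zero]

/-- The projection onto a set of measurement outcomes. -/
def outcomeProj (m : ℕ) (V : Fin n → Matrix.unitaryGroup (Fin 2) ℂ) (S : Finset (Fin n → Fin 2)) :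
    Op (N + m) := embed e m (∑ s ∈ S, productPOVM V s)

theorem outcomeProj_star (V : Fin n → Matrix.unitaryGroup (Fin 2) ℂ)
    (S : Finset (Fin n → Fin 2)) : star (outcomeProj e m V S) = outcomeProj e m V S := by
  rw [outcomeProj, ← embed_star, star_sum]
  simp only [productPOVM_star]

theorem outcomeProj_mul_self (V : Fin n → Matrix.unitaryGroup (Fin 2) ℂ)
    (S : Finset (Fin n → Fin 2)) :
    outcomeProj e m V S * outcomeProj e m V S = outcomeProj e m V S := by
  rw [outcomeProj, ← embed_mul, Finset.sum_mul_sum]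
  congr 1
  refine Finset.sum_congr rfl fun s hs => ?_
  simp [productPOVM_mul, hs]

theorem outcomeProj_mul_mul_eq_zero (V : Fin n → Matrix.unitaryGroup (Fin 2) ℂ) {d : ℕ}
    {S₁ S₂ : Finset (Fin n → Fin 2)} (h : ∀ s ∈ S₁, ∀ t ∈ S₂, d < hammingDist s t)
    {X : Op (N + m)} (hX : X ∈ degLEOne (N + m) ^ d) :
    outcomeProj e m V S₁ * X * outcomeProj e m V S₂ = 0 := by
  rw [outcomeProj, outcomeProj, embed_sum, embed_sum, Finset.sum_mul, Finset.sum_mul]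
  refine Finset.sum_eq_zero fun s hs => ?_
  rw [Finset.mul_sum]
  exact Finset.sum_eq_zero fun t ht => embed_povm_mul_mul_eq_zero e V (h s hs t ht) hX

theorem sum_outcomeProb (V : Fin n → Matrix.unitaryGroup (Fin 2) ℂ) (S : Finset (Fin n → Fin 2))
    (A : Op (N + m)) :
    ∑ s ∈ S, outcomeProb V (qubitState e (traceAncillas m A)) s =
      (outcomeProj e m V S * A).trace.re := by
  simp only [outcomeProb, trace_mul_qubitState, ← trace_ancillaHom_mul]
  rw [outcomeProj, embed_sum, Finset.sum_mul, Matrix.trace_sum, Complex.re_sum]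
  rfl

/-! ### The spread of states prepared from pure Gaussian states -/

/-- Locality makes the polynomial in the number operator vanish between the two outcome sets, while
its Chebyshev bound makes it close to the projection onto σ. Two outcome sets of probability at
least μ permit this only if μ is at most the approximation error. -/
theorem spread_bound {σ U : Op (N + m)} (hσ : IsPureGaussian σ) (hU : U ∈ unitary (Op (N + m)))
    {D : ℕ} (hD : ∀ k, U * majorana k * star U ∈ degLEOne (N + m) ^ D)
    {S : Finset (Fin (2 * (N + m)))}
    (hS : ∀ A ∈ majoranaAlgebra (systemIndices N m), star U * A * U ∈ majoranaAlgebra S)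
    {R : ℝ} (hR : 0 < R) (hSR : (S.card : ℝ) ≤ R) {μ : ℝ} (hμ : 0 < μ) {L : ℕ}
    (hspread : IsSpread μ L (qubitState e (traceAncillas m (U * σ * star U)))) {l : ℕ}
    (hl : D * (2 * l) < L) : μ ≤ (1 + 2 * (l : ℝ) ^ 2 / R)⁻¹ := by
  obtain ⟨V, S₁, S₂, h1, h2, hL⟩ := hspread
  rw [sum_outcomeProb] at h1 h2
  obtain ⟨hσs, hσσ, hσ1, a, ha, haσ, hspan, halin⟩ := hσ.exists_annihilators
  obtain ⟨r, hr, b, hb, hba, hbS⟩ := ha.exists_reduction S majorana star_majorana hspan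
  obtain ⟨hU1, hU2⟩ := Unitary.mem_iff.1 hU
  set P := outcomeProj e m V with hP
  have hQ : ∀ S', ((P S' * (U * σ * star U)).trace) = (star U * P S' * U * σ).trace := by
    intro S'
    rw [← mul_assoc, Matrix.trace_mul_comm]
    simp only [mul_assoc]
  have hQs : ∀ S', star (star U * P S' * U) = star U * P S' * U := by
    intro S'
    rw [star_mul, star_mul, star_star, hP, outcomeProj_star, mul_assoc]
  have hQQ : ∀ S', star U * P S' * U * (star U * P S' * U) = star U * P S' * U := by
    intro S'
    calc star U * P S' * U * (star U * P S' * U) = star U * P S' * (U * star U) * P S' * U := by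
          simp only [mul_assoc]
      _ = star U * (P S' * P S') * U := by rw [hU2, mul_one]; simp only [mul_assoc]
      _ = _ := by rw [hP, outcomeProj_mul_self]
  rw [hQ] at h1 h2
  obtain ⟨f, hfd, hf0, hf⟩ := exists_polynomial_one_at_zero_small l hR
  have hblin : ∀ i, b i ∈ linearSpan (N + m) := fun i =>
    (Submodule.span_le.2 (by rintro _ ⟨j, rfl⟩; exact halin j) :
      Submodule.span ℂ (Set.range a) ≤ _) (hba i)
  -- The number operator is quadratic, the source of the factor 2 in `hl`.
  have hH : numberOp b ∈ degLEOne (N + m) ^ 2 := by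
    rw [pow_two]
    exact sum_mem fun i _ => Submodule.mul_mem_mul
      ((le_sup_right : linearSpan _ ≤ _) (star_mem_linearSpan (hblin i)))
      ((le_sup_right : linearSpan _ ≤ _) (hblin i))
  have hX := conj_mem_degLEOne_pow hU hD (aeval_mem_degLEOne_pow hH f hfd)
  have hzero : star U * P S₁ * U * Polynomial.aeval (numberOp b) f * (star U * P S₂ * U) = 0 := by
    have h3 := outcomeProj_mul_mul_eq_zero e V (S₁ := S₁) (S₂ := S₂) (fun s hs t ht =>
      hl.trans_le (hL.2 ⟨s, hs, t, ht, rfl⟩)) hX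
    calc _ = star U * (P S₁ * (U * Polynomial.aeval (numberOp b) f * star U) * P S₂) * U := by
          simp only [mul_assoc]
      _ = 0 := by rw [hP, h3, mul_zero, zero_mul]
  have hmem : star U * P S₂ * U ∈
      Algebra.adjoin ℂ (Set.range b ∪ Set.range fun i => star (b i)) := by
    have h3 := hS _ (embed_mem_majoranaAlgebra e (m := m) (∑ s ∈ S₂, productPOVM V s))
    refine (Algebra.adjoin_le ?_ : majoranaAlgebra S ≤ _) h3
    rintro _ ⟨k, hk, rfl⟩
    exact hbS k hk
  have hfin := hb.mul_le_sq (fun i => ?_) hσs hσσ hσ1 (hQs S₁) (hQQ S₁) (hQs S₂) (hQQ S₂) hmem hf0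
    (η := (1 + 2 * (l : ℝ) ^ 2 / R)⁻¹) (fun k hk1 hk2 => hf k (by exact_mod_cast hk1)
      ((Nat.cast_le.2 (hk2.trans hr)).trans hSR)) hzero (hμ.trans_le h2)
  · have hη : 0 < (1 + 2 * (l : ℝ) ^ 2 / R)⁻¹ := by positivity
    refine le_of_sq_le_sq ?_ hη.le
    calc μ ^ 2 = μ * μ := sq μ
      _ ≤ _ := mul_le_mul h1 h2 hμ.le (hμ.le.trans h1)
      _ ≤ _ := hfin
  -- The reduced modes are combinations of annihilation operators only, so they still annihilate the
  -- vacuum.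
  · have : Submodule.span ℂ (Set.range a) ≤ LinearMap.ker (LinearMap.mulRight ℂ σ) := by
      rw [Submodule.span_le]
      rintro _ ⟨j, rfl⟩
      exact haσ j
    exact this (hba i)

theorem WellSpreadBelow.exists_isSpread {ε μ c : ℝ} {H : Op n} (hH : WellSpreadBelow ε μ c H)
    {ρ : Op N} (hρ : IsFermionicState ρ) (hE : energy ρ (toFermions e H) < ε * n) :
    ∃ L : ℕ, c * n ≤ L ∧ IsSpread μ L (qubitState e ρ) := by
  refine hH _ (isState_qubitState e hρ.1) ?_
  rwa [energy, Matrix.trace_mul_comm, trace_mul_qubitState, Matrix.trace_mul_comm]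

/-! ### The depth bound -/

/-- With l ≈ cn/(2 · 5^T) the ratio l²/R is of order n/125^T, and it must stay bounded for the
hypothesis to hold. -/
theorem depth_bound {μ c R₀ : ℝ} (hμ : 0 < μ) (hc : 0 < c) (hR₀ : 0 < R₀) :
    ∃ n₀ : ℕ, ∀ n : ℕ, n₀ ≤ n → ∀ (T L : ℕ), c * n ≤ L →
      (∀ l : ℕ, 5 ^ T * (2 * l) < L → μ ≤ (1 + 2 * (l : ℝ) ^ 2 / (R₀ * n * 5 ^ T))⁻¹) →
      (1 / (2 * Real.log 125)) * Real.log n ≤ T := by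
  -- If n > K · 125^T, the bound 4/c ≤ K makes `x` below at least 2, and 8R₀/(c²μ) ≤ K contradicts
  -- the upper bound on μ.
  set K : ℝ := max 1 (max (4 / c) (8 * R₀ / (c ^ 2 * μ))) with hK
  have hK1 : 1 ≤ K := le_max_left _ _
  refine ⟨⌈K ^ 2⌉₊ + 1, fun n hn T L hL h => ?_⟩
  have hnK : K ^ 2 ≤ n := (Nat.le_ceil _).trans (by exact_mod_cast (Nat.le_succ _).trans hn)
  have hnpos : 0 < (n : ℝ) := by
    have : 0 < n := by omega
    exact_mod_cast this
  have hmain : (n : ℝ) ≤ K * 125 ^ T := by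
    by_contra hcon
    push Not at hcon
    have h5 : (0 : ℝ) < 5 ^ T := by positivity
    have h125 : (125 : ℝ) ^ T = 5 ^ T * 5 ^ T * 5 ^ T := by
      rw [← mul_pow, ← mul_pow]; norm_num
    have h5one : (1 : ℝ) ≤ 5 ^ T := one_le_pow₀ (by norm_num)
    set x := c * n / (2 * 5 ^ T) with hx
    have hx2 : 2 ≤ x := by
      rw [hx, le_div_iff₀ (by positivity)]
      have h1 : 4 / c ≤ K := (le_max_left _ _).trans (le_max_right _ _)
      have h2 : 4 ≤ c * K := by rwa [div_le_iff₀' hc] at h1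
      have h3 : (5 : ℝ) ^ T ≤ 125 ^ T := pow_le_pow_left₀ (by norm_num) (by norm_num) T
      calc 2 * (2 * 5 ^ T) = 4 * (5 : ℝ) ^ T := by ring
        _ ≤ c * K * 125 ^ T := mul_le_mul h2 h3 h5.le (by positivity)
        _ = c * (K * 125 ^ T) := by ring
        _ ≤ c * n := mul_le_mul_of_nonneg_left hcon.le hc.le
    have hceil : 2 ≤ ⌈x⌉₊ := by
      have := Nat.le_ceil x
      exact_mod_cast hx2.trans this
    -- The largest integer strictly below `x`: strictness is needed for 5^T · 2l < L, and x ≥ 2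
    -- ensures l ≥ x/2.
    set l := ⌈x⌉₊ - 1 with hl
    have hlx : (l : ℝ) < x := by
      have := Nat.ceil_lt_add_one (by linarith : 0 ≤ x)
      rw [hl, Nat.cast_sub (by omega)]
      push_cast
      linarith
    have hxl : x / 2 ≤ l := by
      have := Nat.le_ceil x
      rw [hl, Nat.cast_sub (by omega)]
      push_cast
      linarith
    have h1 : 5 ^ T * (2 * l) < L := by
      have : (5 : ℝ) ^ T * (2 * l) < L := by
        rw [hx, lt_div_iff₀ (by positivity)] at hlx
        linarith
      exact_mod_cast this
    have h2 := h l h1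
    set R := R₀ * n * 5 ^ T with hR
    have hRpos : 0 < R := by positivity
    have h3 : 2 * (x / 2) ^ 2 / R ≤ 2 * (l : ℝ) ^ 2 / R := by
      gcongr
    have h4 : μ * (2 * (x / 2) ^ 2 / R) < 1 := by
      have h5 : 0 < 1 + 2 * (l : ℝ) ^ 2 / R := by positivity
      rw [le_inv_comm₀ hμ h5] at h2
      have h6 : 2 * (x / 2) ^ 2 / R < μ⁻¹ := by linarith
      calc _ < μ * μ⁻¹ := mul_lt_mul_of_pos_left h6 hμ
        _ = 1 := mul_inv_cancel₀ hμ.ne'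
    have h6 : μ * (2 * (x / 2) ^ 2 / R) = c ^ 2 * μ * n / (8 * R₀ * 125 ^ T) := by
      rw [hx, hR, h125]
      field_simp
      ring
    rw [h6, div_lt_one (by positivity)] at h4
    have h7 : 8 * R₀ / (c ^ 2 * μ) ≤ K := (le_max_right _ _).trans (le_max_right _ _)
    rw [div_le_iff₀ (by positivity)] at h7
    have h8 : 8 * R₀ * 125 ^ T ≤ K * (c ^ 2 * μ) * 125 ^ T :=
      mul_le_mul_of_nonneg_right h7 (by positivity)
    have h9 : K * (c ^ 2 * μ) * 125 ^ T < c ^ 2 * μ * n := by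
      have := mul_lt_mul_of_pos_left hcon (by positivity : 0 < c ^ 2 * μ)
      linarith
    linarith
  have hlog125 : 0 < Real.log 125 := Real.log_pos (by norm_num)
  have h1 : Real.log n ≤ Real.log K + T * Real.log 125 := by
    have := Real.log_le_log hnpos hmain
    rwa [Real.log_mul (by positivity) (by positivity), Real.log_pow] at this
  -- As n ≥ K², the constant log K uses up at most half of log n, hence the 2 in the denominator of
  -- δ.
  have h2 : 2 * Real.log K ≤ Real.log n := by
    have := Real.log_le_log (by positivity) hnK
    rwa [Real.log_pow, Nat.cast_ofNat] at this
  rw [one_div, inv_mul_le_iff₀ (by positivity)]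
  linarith

end

end FNLTS

end

/-! ### Assembly of the three statements. -/

theorem mainTheorem1 (ε μ c : ℝ) (hμ : 0 < μ) (hc : 0 < c) :
    -- the construction preserves locality, sparsity, positivity and the bound on the terms
    (∀ (n N : ℕ), 2 * N = 3 * n → ∀ (e : Fin n × Fin 3 ≃ Fin (2 * N)) (k d : ℕ) (H : FNLTS.Op n),
      FNLTS.IsLocalSparseQubit k d H →
        FNLTS.IsLocalSparseFermionic (3 * k) d (FNLTS.toFermions e H)) ∧
    -- arbitrary Gaussian initialization, arbitrary number of ancillas
    (∃ δ : ℝ, 0 < δ ∧ ∃ n₀ : ℕ, ∀ n : ℕ, n₀ ≤ n → ∀ N : ℕ, 2 * N = 3 * n →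
      ∀ (e : Fin n × Fin 3 ≃ Fin (2 * N)) (H : FNLTS.Op n),
        H.IsHermitian → FNLTS.WellSpreadBelow ε μ c H →
        ∀ ρ : FNLTS.Op N, FNLTS.IsFermionicState ρ →
          FNLTS.energy ρ (FNLTS.toFermions e H) < ε * n →
          ∀ m T : ℕ, FNLTS.Prepares m T ρ → δ * Real.log n ≤ T) ∧
    -- free access to Gaussian operations, linearly many ancillas
    (∀ C : ℝ, ∃ δ : ℝ, 0 < δ ∧ ∃ n₀ : ℕ, ∀ n : ℕ, n₀ ≤ n → ∀ N : ℕ, 2 * N = 3 * n →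
      ∀ (e : Fin n × Fin 3 ≃ Fin (2 * N)) (H : FNLTS.Op n),
        H.IsHermitian → FNLTS.WellSpreadBelow ε μ c H →
        ∀ ρ : FNLTS.Op N, FNLTS.IsFermionicState ρ →
          FNLTS.energy ρ (FNLTS.toFermions e H) < ε * n →
          ∀ m T : ℕ, (m : ℝ) ≤ C * n → FNLTS.PreparesGaussianAssisted m T ρ →
            δ * Real.log n ≤ T) := by
  have hδ : 0 < 1 / (2 * Real.log 125) := by
    have : 0 < Real.log 125 := Real.log_pos (by norm_num)
    positivity
  refine ⟨fun n N _ e k d H hH => FNLTS.isLocalSparseFermionic_toFermions e hH, ?_, fun C => ?_⟩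
  -- The light cone of the 2N = 3n system operators has at most 3n · 5^T elements, whatever the
  -- number of ancillas.
  · obtain ⟨n₀, hn₀⟩ := FNLTS.depth_bound hμ hc (show (0 : ℝ) < 3 by norm_num)
    refine ⟨_, hδ, max n₀ 1, fun n hn N hN e H _ hH ρ hρ hE m T hprep => ?_⟩
    obtain ⟨L, hL, hspread⟩ := hH.exists_isSpread e hρ hE
    obtain ⟨U, σ, hU, hσ, rfl⟩ := hprep
    obtain ⟨hu, hdeg, hcone⟩ := hU.conj
    obtain ⟨S, hS, hSU⟩ := hcone (FNLTS.systemIndices N m)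
    have hnpos : (0 : ℝ) < n := by exact_mod_cast (le_of_max_le_right hn)
    refine hn₀ n (le_of_max_le_left hn) T L hL fun l hl =>
      FNLTS.spread_bound e hσ hu hdeg hSU (by positivity) ?_ hμ hspread hl
    have h1 : S.card ≤ 3 * n * 5 ^ T :=
      (hS.trans (Nat.mul_le_mul_left _ FNLTS.card_systemIndices_le)).trans_eq (by rw [hN, mul_comm])
    exact_mod_cast h1
  -- Without a light cone all 2(N + m) ≤ (3 + 2|C|)n Majorana operators count, which is where
  -- linearly many ancillas are needed. The absolute value keeps the constant positive for every C.
  · obtain ⟨n₀, hn₀⟩ := FNLTS.depth_bound hμ hc (show (0 : ℝ) < 3 + 2 * |C| by positivity)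
    refine ⟨_, hδ, max n₀ 1, fun n hn N hN e H _ hH ρ hρ hE m T hm hprep => ?_⟩
    obtain ⟨L, hL, hspread⟩ := hH.exists_isSpread e hρ hE
    obtain ⟨U, σ, hU, hσ, rfl⟩ := hprep
    obtain ⟨hu, hdeg, hcone⟩ := hU.conj
    have hnpos : (0 : ℝ) < n := by exact_mod_cast (le_of_max_le_right hn)
    refine hn₀ n (le_of_max_le_left hn) T L hL fun l hl =>
      FNLTS.spread_bound e hσ hu hdeg (S := Finset.univ)
        (fun A hA => hcone A (FNLTS.majoranaAlgebra_mono (Finset.subset_univ _) hA))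
        (by positivity) ?_ hμ hspread hl
    rw [Finset.card_univ, Fintype.card_fin]
    have h1 : ((2 * (N + m) : ℕ) : ℝ) ≤ (3 + 2 * |C|) * n := by
      have h2 : (2 * N : ℝ) = 3 * n := by exact_mod_cast hN
      have h3 : C * n ≤ |C| * n := mul_le_mul_of_nonneg_right (le_abs_self C) hnpos.le
      push_cast
      linarith
    -- The factor 5^T is not needed here and is added only to match `depth_bound`.
    refine h1.trans (le_mul_of_one_le_right (by positivity) (one_le_pow₀ (by norm_num)))
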